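/- **Setting.** There are $n$ workers and a server. A problem consists of differentiable functions $f_1,\dots,f_n:\mathbb R^d\to\mathbb R$, $f=\frac1n\sum_i f_i$. The class $\mathcal F_{\Delta,L}$ requires every $\nabla f_i$ to be $L$-Lipschitz and $f(x^{(0)})-\inf f\le\Delta$, where $x^{(0)}=0$ is the initial point. A stochastic oracle $O_i(x;\zeta_i)$ is in $\mathcal O_{\sigma^2}$ if $\mathbb E[O_i(x;\zeta_i)]=\nabla f_i(x)$ and $\mathbb E\|O_i(x;\zeta_i)-\nabla f_i(x)\|^2\le\sigma^2$ for all $x$. A random map $C:\mathbb R^d\to\mathbb R^d$ is a $\delta$-contractive compressor if $\mathbb E\|C(x)-x\|^2\le(1-\delta)\|x\|^2$ for all $x$. An algorithm with unidirectional compression is centralized and synchronous and proceeds in phases $t=1,2,\dots$. In phase $t$ each worker $i$ queries its oracle at a point $y_i^{(t)}$ (with fresh noise, independent over workers and phases) and obtains $g_i^{(t)}$; then, in some number of synchronous communication rounds, every worker sends one vector per round to the server, which receives the vectors after compression by $C_i$ (the randomness of $(C_1,\dots,C_n)$ is independent from round to round, but in one round the $C_i$ may be dependent); the server broadcasts a finite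 set of vectors without compression ($C_0=I$); finally each worker forms its local model $x_i^{(t)}$. Workers act on their own history, the server on the messages it has received; the algorithm may be randomized. Initially $x_i^{(0)}=x^{(0)}=0$ for all $i$. The algorithm is zero-respecting if, for every coordinate $k$ and phase $t$ (almost surely): 1. if $[y_i^{(t)}]_k\ne0$, then the $k$-th coordinate is non-zero in some $x_i^{(s)}$ with $0\le s<t$, or in some $g_i^{(s)}$, some vector broadcast in phase $s$, or some compressed vector sent by worker $i$ in phase $s$, with $1\le s<t$; 2. if $[x_i^{(t)}]_k\neq0$, the same holds with $1\le s\le t$ in place of $1\le s<t$ (still $s<t$ for the models $x_i^{(s)}$); 3. if a vector that worker $i$ wants to send in phase $t$ has non-zero $k$-th coordinate, then so has some $x_i^{(s)}$ with $0\le s<t$, or some $g_i^{(s)}$ with $1\le s\le t$, or some vector broadcast, or some compressed vector sent by worker $i$, in a phase $1\le s<t$; 4. if a vector broadcast in phase $t$ has non-zero $k$-th coordinate, then so has some compressed vector received by the server from some worker in a phase $1\le s\le t$, or some vector broadcast in a phase $1\le s<t$. With a budget $T$ the algorithm makes $T$ phases (hence $T$ gradient queries per worker) with at most $T$ communication rounds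 in total, and its output $\hat x$ is any (possibly random) linear combination of the local models $x_i^{(s)}$, $0\le s\le T$, $1\le i\le n$. **Theorem.** For every $\kappa>0$ there is a constant $c>0$, depending only on $\kappa$, such that the following holds. For all $\Delta,L,\sigma>0$, $n\ge2$, $0<\delta\le1$ and every integer $T$ with $T\ge\delta^{-2}$ and $T\ge\kappa\,\frac{\sigma^2}{nL\Delta}$ there exist a dimension $d\geq 1$, local functions $\{f_i\}_{i=1}^n\subseteq\mathcal F_{\Delta,L}$ on $\mathbb R^d$, oracles $\{O_i\}_{i=1}^n\subseteq\mathcal O_{\sigma^2}$ and $\delta$-contractive compressors $\{C_i\}_{i=1}^n$ (and $C_0=I$) such that for every zero-respecting algorithm with unidirectional compression started at $x^{(0)}=0$, every output $\hat x$ with budget $T$ satisfies $$\mathbb E\|\nabla f(\hat x)\|^2\;\ge\;c\left(\Big(\frac{\Delta L\sigma^2}{nT}\Big)^{1/2}+\frac{\Delta L}{\delta T}\right).$$ -/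

import Mathlib

open MeasureTheory

universe u

noncomputable section

namespace DistComp

/-- The space `ℝ^d` with its Euclidean norm. -/
abbrev E (d : ℕ) : Type := EuclideanSpace ℝ (Fin d)

/-! ### Function class -/

/-- The global objective `f = (1/n) ∑ i, f i`. -/
def average {n d : ℕ} (f : Fin n → E d → ℝ) (x : E d) : ℝ := (∑ i, f i x) / n

/-- The local objectives `f 1, …, f n` on `ℝ^d` belong to the class `F_{Δ,L}` with initialization
point `x0`: every `f i` is differentiable with `L`-Lipschitz gradient, and the average `f` is
bounded below with `f x0 - inf f ≤ Δ`. -/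
structure SmoothClass {n d : ℕ} (Δ L : ℝ) (x0 : E d) (f : Fin n → E d → ℝ) : Prop where
  differentiable : ∀ i, Differentiable ℝ (f i)
  lipschitz : ∀ i x y, ‖gradient (f i) x - gradient (f i) y‖ ≤ L * ‖x - y‖
  bddBelow : BddBelow (Set.range (average f))
  gap : average f x0 - ⨅ x, average f x ≤ Δ

/-! ### Stochastic gradient oracles -/

/-- A stochastic oracle `O (x; ζ)` on `ℝ^d`, with `ζ` drawn from the probability measure `law`. -/
structure Oracle (d : ℕ) where
  Noise : Type
  [mNoise : MeasurableSpace Noise]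
  law : Measure Noise
  [prob : IsProbabilityMeasure law]
  eval : E d → Noise → E d

attribute [instance] Oracle.mNoise Oracle.prob

/-- The oracle is an unbiased estimator of `∇ f` with variance at most `σ ^ 2`. -/
structure Oracle.InClass {d : ℕ} (O : Oracle d) (σ : ℝ) (f : E d → ℝ) : Prop where
  measurable : Measurable (fun p : E d × O.Noise => O.eval p.1 p.2)
  integrable : ∀ x, Integrable (O.eval x) O.law
  unbiased : ∀ x, ∫ z, O.eval x z ∂O.law = gradient f x
  variance : ∀ x, ∫⁻ z, ‖O.eval x z - gradient f x‖ₑ ^ 2 ∂O.law ≤ ENNReal.ofReal (σ ^ 2)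

/-! ### Compressors -/

/-- A family of random compression operators `C 1, …, C n` of the workers, realised on one common
probability space, so that they may be dependent (for instance share their randomness) or not. -/
structure Compressors (n d : ℕ) where
  Rand : Type
  [mRand : MeasurableSpace Rand]
  law : Measure Rand
  [prob : IsProbabilityMeasure law]
  compress : Fin n → Rand → E d → E d

attribute [instance] Compressors.mRand Compressors.prob

/-- Every member of the family is a `δ`-contractive compressor. -/
structure Compressors.Contractive {n d : ℕ} (C : Compressors n d) (δ : ℝ) : Prop where
  measurable : ∀ i, Measurable (fun p : C.Rand × E d => C.compress i p.1 p.2)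
  contract : ∀ i x, ∫⁻ θ, ‖C.compress i θ x - x‖ₑ ^ 2 ∂C.law ≤ ENNReal.ofReal ((1 - δ) * ‖x‖ ^ 2)

/-! ### Algorithms

A run is divided into phases.  In every phase, synchronously,
1. each worker queries its gradient oracle once;
2. there are `m` rounds of communication, in each of which every worker transmits one vector to the
   server through its compressor (transmitting the zero vector amounts to staying silent);
3. the server broadcasts a finite list of vectors to all workers, without compression;
4. each worker updates its local model. -/

/-- What a worker learns in one phase: the oracle's answer, the compressed versions of the vectors
it transmitted, and the vectors broadcast by the server. -/
structure WorkerRecord (d : ℕ) where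
  grad : E d
  sent : List (E d)
  recv : List (E d)

/-- What the server learns in one phase: the compressed vectors that arrive from each worker. -/
abbrev ServerRecord (n d : ℕ) : Type := Fin n → List (E d)

/-- A centralized, synchronous, possibly randomized algorithm for `n` workers in `ℝ^d` (its own
randomness is drawn once from `law`).  Workers act on their own history only, and the server acts
on the history of the messages it has received; histories are in chronological order.
* `query`: the point at which a worker queries its oracle, from the previous phases;
* `rounds`: the number `m` of communication rounds of the phase, from the previous phases;
* `send`: the `m` vectors a worker wants to transmit, from the previous phases and the new answer
  of its oracle;
* `broadcast`: the vectors that the server broadcasts, from the messages received up to and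
  including this phase;
* `model`: the local model of a worker, from the phases completed so far. -/
structure Algorithm (n d : ℕ) where
  Coin : Type u
  [mCoin : MeasurableSpace Coin]
  law : Measure Coin
  [prob : IsProbabilityMeasure law]
  query : Coin → Fin n → List (WorkerRecord d) → E d
  rounds : Coin → List (ServerRecord n d) → ℕ
  send : Coin → Fin n → List (WorkerRecord d) → E d → (m : ℕ) → Fin m → E d
  broadcast : Coin → List (ServerRecord n d) → List (E d)
  model : Coin → Fin n → List (WorkerRecord d) → E d

attribute [instance] Algorithm.mCoin Algorithm.prob

/-! ### Runs -/

section Run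

variable {n d : ℕ} (A : Algorithm.{u} n d) (O : Fin n → Oracle d) (C : Compressors n d)

/-- Outcomes: the coin of the algorithm, the oracle noise `ζ (i, t)` of worker `i` in phase `t`, and
the compressor randomness `θ r` of the `r`-th round of communication of the run. -/
abbrev Outcome : Type u := A.Coin × (∀ p : Fin n × ℕ, (O p.1).Noise) × (ℕ → C.Rand)

/-- The probability measure on outcomes: all the random elements are independent. -/
def outcomeLaw : Measure (Outcome A O C) :=
  A.law.prod ((Measure.infinitePi fun p : Fin n × ℕ => (O p.1).law).prod
    (Measure.infinitePi fun _ : ℕ => C.law))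

/-- The histories after some number of phases, and the number of communication rounds used. -/
structure State (n d : ℕ) where
  worker : Fin n → List (WorkerRecord d)
  server : List (ServerRecord n d)
  used : ℕ

variable {O C}

/-- The point that worker `i` queries in the phase `t` that starts from state `S`. -/
def State.query (S : State n d) (ω : Outcome A O C) (i : Fin n) : E d :=
  A.query ω.1 i (S.worker i)

/-- The answer of the oracle of worker `i` in the phase `t` that starts from state `S`. -/
def State.grad (S : State n d) (ω : Outcome A O C) (t : ℕ) (i : Fin n) : E d :=
  (O i).eval (S.query A ω i) (ω.2.1 (i, t))

/-- The number of communication rounds in the phase that starts from state `S`. -/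
def State.rounds (S : State n d) (ω : Outcome A O C) : ℕ := A.rounds ω.1 S.server

/-- The vectors that worker `i` aims to send to the server, before compression. -/
def State.target (S : State n d) (ω : Outcome A O C) (t : ℕ) (i : Fin n) :
    Fin (S.rounds A ω) → E d :=
  A.send ω.1 i (S.worker i) (S.grad A ω t i) (S.rounds A ω)

/-- The compressed vectors that the server receives from worker `i`; the randomness of the
compressors is fresh in every round. -/
def State.message (S : State n d) (ω : Outcome A O C) (t : ℕ) (i : Fin n) : List (E d) :=
  List.ofFn fun r : Fin (S.rounds A ω) =>
    C.compress i (ω.2.2 (S.used + r)) (S.target A ω t i r)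

/-- The vectors that the server broadcasts; the workers receive them unchanged. -/
def State.broadcast (S : State n d) (ω : Outcome A O C) (t : ℕ) : List (E d) :=
  A.broadcast ω.1 (S.server ++ [S.message A ω t])

/-- The state after `t` phases. -/
def state (ω : Outcome A O C) : ℕ → State n d
  | 0 => ⟨fun _ => [], [], 0⟩
  | t + 1 =>
    let S := state ω t
    { worker := fun i =>
        S.worker i ++ [⟨S.grad A ω t i, S.message A ω t i, S.broadcast A ω t⟩]
      server := S.server ++ [S.message A ω t]
      used := S.used + S.rounds A ω }

/-- The local model of worker `i` after `t` phases; `t = 0` is the initial model. -/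
def xAt (ω : Outcome A O C) (i : Fin n) (t : ℕ) : E d :=
  A.model ω.1 i ((state A ω t).worker i)

/-- The query point of worker `i` in phase `t`.  Phases are numbered from `0`. -/
def yAt (ω : Outcome A O C) (i : Fin n) (t : ℕ) : E d := (state A ω t).query A ω i

/-- The oracle's answer to worker `i` in phase `t`. -/
def gAt (ω : Outcome A O C) (i : Fin n) (t : ℕ) : E d := (state A ω t).grad A ω t i

/-- The set of vectors that worker `i` aims to send to the server in phase `t`. -/
def targetAt (ω : Outcome A O C) (i : Fin n) (t : ℕ) : Set (E d) :=
  Set.range ((state A ω t).target A ω t i)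

/-- The set of compressed vectors that the server receives from worker `i` in phase `t`. -/
def upAt (ω : Outcome A O C) (i : Fin n) (t : ℕ) : Set (E d) :=
  {v | v ∈ (state A ω t).message A ω t i}

/-- The set of vectors that the server broadcasts in phase `t`. -/
def downAt (ω : Outcome A O C) (t : ℕ) : Set (E d) :=
  {v | v ∈ (state A ω t).broadcast A ω t}

/-- The run with outcome `ω` is zero-respecting during its first `T` phases.  Phase `t` makes the
`(t + 1)`-st query and ends with the local models `x (t + 1)`. -/
structure ZeroRespecting (T : ℕ) (ω : Outcome A O C) : Prop where
  query : ∀ t < T, ∀ (i : Fin n) (k : Fin d), yAt A ω i t k ≠ 0 →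
    (∃ s ≤ t, xAt A ω i s k ≠ 0) ∨ (∃ s < t, gAt A ω i s k ≠ 0) ∨
    (∃ s < t, ∃ v ∈ downAt A ω s, v k ≠ 0) ∨ (∃ s < t, ∃ v ∈ upAt A ω i s, v k ≠ 0)
  model : ∀ t < T, ∀ (i : Fin n) (k : Fin d), xAt A ω i (t + 1) k ≠ 0 →
    (∃ s ≤ t, xAt A ω i s k ≠ 0) ∨ (∃ s ≤ t, gAt A ω i s k ≠ 0) ∨
    (∃ s ≤ t, ∃ v ∈ downAt A ω s, v k ≠ 0) ∨ (∃ s ≤ t, ∃ v ∈ upAt A ω i s, v k ≠ 0)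
  send : ∀ t < T, ∀ (i : Fin n) (k : Fin d), ∀ u ∈ targetAt A ω i t, u k ≠ 0 →
    (∃ s ≤ t, xAt A ω i s k ≠ 0) ∨ (∃ s ≤ t, gAt A ω i s k ≠ 0) ∨
    (∃ s < t, ∃ v ∈ downAt A ω s, v k ≠ 0) ∨ (∃ s < t, ∃ v ∈ upAt A ω i s, v k ≠ 0)
  broadcast : ∀ t < T, ∀ (k : Fin d), ∀ u ∈ downAt A ω t, u k ≠ 0 →
    (∃ s ≤ t, ∃ i, ∃ v ∈ upAt A ω i s, v k ≠ 0) ∨ (∃ s < t, ∃ v ∈ downAt A ω s, v k ≠ 0)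

variable (O C)

/-- The algorithm, run on the oracles `O` and compressors `C` (with lossless broadcast), starts from
`x0`, is almost surely zero-respecting, and in its `T` phases, each with one gradient query per
worker, almost surely uses at most `T` rounds of communication. -/
structure Admissible (x0 : E d) (T : ℕ) : Prop where
  start : ∀ (ω : Outcome A O C) (i : Fin n), xAt A ω i 0 = x0
  zeroRespecting : ∀ᵐ ω ∂(outcomeLaw A O C), ZeroRespecting A T ω
  budget : ∀ᵐ ω ∂(outcomeLaw A O C), (state A ω T).used ≤ T

/-- `xhat` is a possible output after `T` phases: it is almost surely a linear combination (with
arbitrary, possibly random coefficients) of the local models produced so far. -/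
def IsOutput (T : ℕ) (xhat : Outcome A O C → E d) : Prop :=
  ∀ᵐ ω ∂(outcomeLaw A O C),
    xhat ω ∈ Submodule.span ℝ {x | ∃ (i : Fin n) (s : ℕ), s ≤ T ∧ x = xAt A ω i s}

end Run

end DistComp

end

noncomputable section

namespace DistComp

/-! ### A piecewise quadratic chain -/

/-! It suffices to have one hard instance for each of the two terms and to use the one whose term is
larger; this costs a factor 2. Both rest on `chain`, a sum of d+1 links between consecutive
coordinates, scaled by `scale_identities` to exhaust L and Δ. By `below_chainGrad`, at a point
vanishing from coordinate m on, the gradient reaches at most coordinate m, and only through link m.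
By `le_norm_chainGrad`, while some coordinate is still zero, the squared gradient is at least of
order LΔ/d. So d should be as small as possible, subject to the last coordinate staying unreached
with probability at least 1/2 (`lintegral_gradient_ge`).

Compression (`exists_hard_for_compression`): even links belong to even workers, odd links to odd
ones, so no worker crosses two links without news from the server. The compressors erase all
messages of a round together with probability 1-δ. Progress is then at most one more than the number
of surviving rounds, whose mean is at most δT; d of order δT gives LΔ/(δT).

Noise (`exists_hard_for_noise`): every worker holds the whole chain and communication is lossless,
but the next partial derivative is shown only if a coin of bias p succeeds. About nTp coins succeed,
so d is of order nTp, while the variance allows p of order LΔ/(dσ²). Hence d is of order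
(nTLΔ/σ²)^{1/2}, and LΔ/d is the statistical term.

In both cases `ZeroRespecting.progress` bounds the supports by a count of coin successes over an
index set that does not depend on the algorithm. Markov's inequality therefore suffices, without
conditioning on the history. -/

/-- A `C^{1,1}` step from `0` (left of `0`) to `1` (right of `1`). -/
def step (z : ℝ) : ℝ := 2 * max z 0 ^ 2 - 4 * max (z - 1 / 2) 0 ^ 2 + 2 * max (z - 1) 0 ^ 2

/-- The derivative of `step`. -/
def stepDeriv (z : ℝ) : ℝ := 4 * max z 0 - 8 * max (z - 1 / 2) 0 + 4 * max (z - 1) 0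

/-- A step from `0` at `-2` to `1` at `2`. -/
def wideStep (z : ℝ) : ℝ := step ((z + 2) / 4)

/-- The derivative of `wideStep`. -/
def wideStepDeriv (z : ℝ) : ℝ := stepDeriv ((z + 2) / 4) / 4

/-- A quadratic penalty on the negative half-line. -/
def well (z : ℝ) : ℝ := max (-z) 0 ^ 2 / 2

/-- The derivative of `well`. -/
def wellDeriv (z : ℝ) : ℝ := -max (-z) 0

/-! ### Derivatives, bounds and Lipschitz constants of the scalar profiles. -/

lemma hasDerivAt_max_zero_sq (z : ℝ) :
    HasDerivAt (fun z : ℝ => max z 0 ^ 2) (2 * max z 0) z := by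
  rcases lt_trichotomy z 0 with h | h | h
  · rw [max_eq_right h.le, mul_zero]
    refine (hasDerivAt_const z (0 : ℝ)).congr_of_eventuallyEq ?_
    filter_upwards [gt_mem_nhds h] with y hy
    simp [max_eq_right (le_of_lt hy)]
  · subst h
    rw [hasDerivAt_iff_isLittleO_nhds_zero]
    simp only [zero_add, max_self, mul_zero, smul_zero, sub_zero, ne_eq, OfNat.ofNat_ne_zero,
      not_false_eq_true, zero_pow]
    refine (Asymptotics.isBigO_of_le _ (g := fun h : ℝ => h ^ 2) fun h => ?_).trans_isLittleO
      (Asymptotics.isLittleO_pow_id one_lt_two)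
    rw [Real.norm_eq_abs, Real.norm_eq_abs, abs_of_nonneg (sq_nonneg _),
      abs_of_nonneg (sq_nonneg _)]
    rcases max_cases h 0 with ⟨h1, h2⟩ | ⟨h1, h2⟩
    · rw [h1]
    · rw [h1]; nlinarith
  · rw [max_eq_left h.le]
    have h2 : HasDerivAt (fun z : ℝ => z ^ 2) (2 * z) z := by simpa using hasDerivAt_pow 2 z
    refine h2.congr_of_eventuallyEq ?_
    filter_upwards [lt_mem_nhds h] with y hy
    simp [max_eq_left (le_of_lt hy)]

lemma hasDerivAt_step (z : ℝ) : HasDerivAt step (stepDeriv z) z := by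
  have h1 := (hasDerivAt_max_zero_sq z).const_mul 2
  have h2 := ((hasDerivAt_max_zero_sq (z - 1 / 2)).comp z
    ((hasDerivAt_id z).sub_const (1 / 2))).const_mul 4
  have h3 := ((hasDerivAt_max_zero_sq (z - 1)).comp z
    ((hasDerivAt_id z).sub_const 1)).const_mul 2
  refine ((h1.sub h2).add h3).congr_deriv ?_
  simp only [stepDeriv]; ring

lemma hasDerivAt_wideStep (z : ℝ) : HasDerivAt wideStep (wideStepDeriv z) z :=
  ((hasDerivAt_step ((z + 2) / 4)).comp z
    (((hasDerivAt_id z).add_const 2).div_const 4)).congr_deriv (by simp only [wideStepDeriv]; ring)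

lemma hasDerivAt_well (z : ℝ) : HasDerivAt well (wellDeriv z) z :=
  (((hasDerivAt_max_zero_sq (-z)).comp z (hasDerivAt_neg z)).div_const 2).congr_deriv
    (by simp only [wellDeriv]; ring)

lemma step_nonneg (z : ℝ) : 0 ≤ step z := by
  unfold step
  rcases max_cases z 0 with ⟨h1, h2⟩ | ⟨h1, h2⟩ <;>
  rcases max_cases (z - 1 / 2) 0 with ⟨h3, h4⟩ | ⟨h3, h4⟩ <;>
  rcases max_cases (z - 1) 0 with ⟨h5, h6⟩ | ⟨h5, h6⟩ <;> rw [h1, h3, h5] <;> nlinarith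

lemma step_le_one (z : ℝ) : step z ≤ 1 := by
  unfold step
  rcases max_cases z 0 with ⟨h1, h2⟩ | ⟨h1, h2⟩ <;>
  rcases max_cases (z - 1 / 2) 0 with ⟨h3, h4⟩ | ⟨h3, h4⟩ <;>
  rcases max_cases (z - 1) 0 with ⟨h5, h6⟩ | ⟨h5, h6⟩ <;> rw [h1, h3, h5] <;> nlinarith

lemma abs_step_le_one (z : ℝ) : |step z| ≤ 1 := by
  rw [abs_of_nonneg (step_nonneg z)]; exact step_le_one z

lemma step_zero : step 0 = 0 := by norm_num [step]

lemma step_eq_one {z : ℝ} (hz : 1 ≤ z) : step z = 1 := by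
  unfold step
  rw [max_eq_left (by linarith), max_eq_left (by linarith), max_eq_left (by linarith)]; ring

lemma stepDeriv_zero : stepDeriv 0 = 0 := by norm_num [stepDeriv]

lemma stepDeriv_nonneg (z : ℝ) : 0 ≤ stepDeriv z := by
  unfold stepDeriv
  rcases max_cases z 0 with ⟨h1, h2⟩ | ⟨h1, h2⟩ <;>
  rcases max_cases (z - 1 / 2) 0 with ⟨h3, h4⟩ | ⟨h3, h4⟩ <;>
  rcases max_cases (z - 1) 0 with ⟨h5, h6⟩ | ⟨h5, h6⟩ <;> rw [h1, h3, h5] <;> linarith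

lemma stepDeriv_le_two (z : ℝ) : stepDeriv z ≤ 2 := by
  unfold stepDeriv
  rcases max_cases z 0 with ⟨h1, h2⟩ | ⟨h1, h2⟩ <;>
  rcases max_cases (z - 1 / 2) 0 with ⟨h3, h4⟩ | ⟨h3, h4⟩ <;>
  rcases max_cases (z - 1) 0 with ⟨h5, h6⟩ | ⟨h5, h6⟩ <;> rw [h1, h3, h5] <;> linarith

lemma abs_stepDeriv_le (z : ℝ) : |stepDeriv z| ≤ 2 := by
  rw [abs_of_nonneg (stepDeriv_nonneg z)]; exact stepDeriv_le_two z

lemma one_le_stepDeriv {z : ℝ} (h0 : 1 / 4 ≤ z) (h1 : z ≤ 3 / 4) : 1 ≤ stepDeriv z := by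
  unfold stepDeriv
  rw [max_eq_left (by linarith : (0 : ℝ) ≤ z), max_eq_right (by linarith : z - 1 ≤ 0)]
  rcases max_cases (z - 1 / 2) 0 with ⟨h3, h4⟩ | ⟨h3, h4⟩ <;> rw [h3] <;> linarith

lemma stepDeriv_lipschitz (x y : ℝ) : |stepDeriv x - stepDeriv y| ≤ 4 * |x - y| := by
  wlog hxy : y ≤ x generalizing x y
  · rw [abs_sub_comm, abs_sub_comm x]; exact this y x (le_of_not_ge hxy)
  rw [abs_of_nonneg (sub_nonneg.2 hxy), abs_le]
  unfold stepDeriv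
  constructor <;>
  rcases max_cases x 0 with ⟨h1, h2⟩ | ⟨h1, h2⟩ <;>
  rcases max_cases (x - 1 / 2) 0 with ⟨h3, h4⟩ | ⟨h3, h4⟩ <;>
  rcases max_cases (x - 1) 0 with ⟨h5, h6⟩ | ⟨h5, h6⟩ <;> rw [h1, h3, h5] <;>
  rcases max_cases y 0 with ⟨k1, k2⟩ | ⟨k1, k2⟩ <;>
  rcases max_cases (y - 1 / 2) 0 with ⟨k3, k4⟩ | ⟨k3, k4⟩ <;>
  rcases max_cases (y - 1) 0 with ⟨k5, k6⟩ | ⟨k5, k6⟩ <;> rw [k1, k3, k5] <;> linarith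

lemma step_lipschitz (x y : ℝ) : |step x - step y| ≤ 2 * |x - y| := by
  simpa [Real.norm_eq_abs] using Convex.norm_image_sub_le_of_norm_hasDerivWithin_le
    (f := step) (f' := stepDeriv) (C := 2) (s := Set.univ) (x := y) (y := x)
    (fun z _ => (hasDerivAt_step z).hasDerivWithinAt)
    (fun z _ => by simpa [Real.norm_eq_abs] using abs_stepDeriv_le z) convex_univ trivial trivial

lemma wideStep_nonneg (z : ℝ) : 0 ≤ wideStep z := step_nonneg _

lemma wideStep_le_one (z : ℝ) : wideStep z ≤ 1 := step_le_one _

lemma abs_wideStep_le_one (z : ℝ) : |wideStep z| ≤ 1 := abs_step_le_one _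

lemma wideStepDeriv_nonneg (z : ℝ) : 0 ≤ wideStepDeriv z :=
  div_nonneg (stepDeriv_nonneg _) (by norm_num)

lemma abs_wideStepDeriv_le (z : ℝ) : |wideStepDeriv z| ≤ 1 / 2 := by
  have := stepDeriv_le_two ((z + 2) / 4)
  rw [abs_of_nonneg (wideStepDeriv_nonneg z)]; unfold wideStepDeriv; linarith

lemma le_wideStepDeriv {z : ℝ} (h0 : -1 ≤ z) (h1 : z ≤ 1) : 1 / 4 ≤ wideStepDeriv z := by
  have := one_le_stepDeriv (z := (z + 2) / 4) (by linarith) (by linarith)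
  unfold wideStepDeriv; linarith

lemma wideStep_lipschitz (x y : ℝ) : |wideStep x - wideStep y| ≤ 1 / 2 * |x - y| := by
  have := step_lipschitz ((x + 2) / 4) ((y + 2) / 4)
  rw [show (x + 2) / 4 - (y + 2) / 4 = (x - y) / 4 by ring, abs_div,
    abs_of_pos (by norm_num : (0 : ℝ) < 4)] at this
  unfold wideStep; linarith

lemma wideStepDeriv_lipschitz (x y : ℝ) :
    |wideStepDeriv x - wideStepDeriv y| ≤ 1 / 4 * |x - y| := by
  have := stepDeriv_lipschitz ((x + 2) / 4) ((y + 2) / 4)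
  rw [show (x + 2) / 4 - (y + 2) / 4 = (x - y) / 4 by ring, abs_div,
    abs_of_pos (by norm_num : (0 : ℝ) < 4)] at this
  unfold wideStepDeriv
  rw [← sub_div, abs_div, abs_of_pos (by norm_num : (0 : ℝ) < 4)]; linarith

lemma well_nonneg (z : ℝ) : 0 ≤ well z := by unfold well; positivity

lemma well_zero : well 0 = 0 := by norm_num [well]

lemma wellDeriv_zero : wellDeriv 0 = 0 := by norm_num [wellDeriv]

lemma wellDeriv_nonpos (z : ℝ) : wellDeriv z ≤ 0 := by
  unfold wellDeriv; linarith [le_max_right (-z) 0]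

lemma wellDeriv_le {z : ℝ} (h : z ≤ -1) : wellDeriv z ≤ -1 := by
  unfold wellDeriv; linarith [le_max_left (-z) 0]

lemma wellDeriv_lipschitz (x y : ℝ) : |wellDeriv x - wellDeriv y| ≤ |x - y| := by
  unfold wellDeriv
  have := abs_max_sub_max_le_abs (-x) (-y) 0
  rw [show -x - -y = -(x - y) by ring, abs_neg] at this
  rwa [show -max (-x) 0 - -max (-y) 0 = -(max (-x) 0 - max (-y) 0) by ring, abs_neg]

/-- The partial derivative of the chain with link weights `w` in its coordinate `k + 1`. -/
def slope (w u : ℕ → ℝ) (k : ℕ) : ℝ :=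
  w k * (-(step (u k) * wideStepDeriv (u (k + 1))) + wellDeriv (u (k + 1))) -
    w (k + 1) * (stepDeriv (u (k + 1)) * wideStep (u (k + 2)))

lemma abs_mul_sub_mul_le {p q p' q' : ℝ} : |p * q - p' * q'| ≤ |p| * |q - q'| + |p - p'| * |q'| := by
  rw [← abs_mul, ← abs_mul, show p * q - p' * q' = p * (q - q') + (p - p') * q' by ring]
  exact abs_add_le _ _

lemma slope_lipschitz {w : ℕ → ℝ} (h0 : ∀ k, 0 ≤ w k) (h1 : ∀ k, w k ≤ 1) (u v : ℕ → ℝ) (k : ℕ) :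
    |slope w u k - slope w v k| ≤
      |u k - v k| + 6 * |u (k + 1) - v (k + 1)| + |u (k + 2) - v (k + 2)| := by
  have e1 : |step (u k) * wideStepDeriv (u (k + 1)) - step (v k) * wideStepDeriv (v (k + 1))| ≤
      1 / 4 * |u (k + 1) - v (k + 1)| + |u k - v k| := by
    refine abs_mul_sub_mul_le.trans (add_le_add ?_ ?_)
    · calc _ ≤ 1 * (1 / 4 * |u (k + 1) - v (k + 1)|) := by
            gcongr
            exacts [abs_step_le_one _, wideStepDeriv_lipschitz _ _]
        _ = _ := one_mul _
    · calc _ ≤ (2 * |u k - v k|) * (1 / 2) := by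
            gcongr
            exacts [step_lipschitz _ _, abs_wideStepDeriv_le _]
        _ = _ := by ring
  have e2 : |stepDeriv (u (k + 1)) * wideStep (u (k + 2)) -
      stepDeriv (v (k + 1)) * wideStep (v (k + 2))| ≤
      |u (k + 2) - v (k + 2)| + 4 * |u (k + 1) - v (k + 1)| := by
    refine abs_mul_sub_mul_le.trans (add_le_add ?_ ?_)
    · calc _ ≤ 2 * (1 / 2 * |u (k + 2) - v (k + 2)|) := by
            gcongr
            exacts [abs_stepDeriv_le _, wideStep_lipschitz _ _]
        _ = _ := by ring
    · calc _ ≤ (4 * |u (k + 1) - v (k + 1)|) * 1 := by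
            gcongr
            exacts [stepDeriv_lipschitz _ _, abs_wideStep_le_one _]
        _ = _ := mul_one _
  have e3 := wellDeriv_lipschitz (u (k + 1)) (v (k + 1))
  have key : ∀ (b c x : ℝ), 0 ≤ b → b ≤ 1 → |x| ≤ c → |b * x| ≤ c := fun b c x hb hb' hx => by
    rw [abs_mul, abs_of_nonneg hb]; nlinarith [abs_nonneg x]
  have e4 := key (w k) _ _ (h0 k) (h1 k) ((abs_sub _ _).trans (add_le_add e3 e1))
  have e5 := key (w (k + 1)) _ _ (h0 _) (h1 _) e2
  have := (abs_sub _ _).trans (add_le_add e4 e5)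
  refine le_trans (le_of_eq ?_) (this.trans ?_)
  · unfold slope; congr 1; ring
  -- The middle coefficients add up to 1 + 1/4 + 4; rounding up to 6 makes the three coefficients
  -- sum to 8.
  · nlinarith [abs_nonneg (u (k + 1) - v (k + 1))]

/-- Where the sequence drops past 1, `step` is saturated and `wideStep` has slope at least 1/4 on
[-1,1]; further left that slope may vanish and `well` takes over. The next link contributes with the
same sign, so nothing cancels. -/
lemma slope_le {w u : ℕ → ℝ} {b : ℝ} (hb : 0 ≤ b) (h0 : ∀ k, b ≤ w k) {k : ℕ} (hk : 1 ≤ u k)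
    (hk' : u (k + 1) ≤ 1) : slope w u k ≤ -(b / 4) := by
  unfold slope
  rw [step_eq_one hk, one_mul]
  have e1 : 0 ≤ w (k + 1) * (stepDeriv (u (k + 1)) * wideStep (u (k + 2))) :=
    mul_nonneg (hb.trans (h0 _)) (mul_nonneg (stepDeriv_nonneg _) (wideStep_nonneg _))
  have e2 : -wideStepDeriv (u (k + 1)) + wellDeriv (u (k + 1)) ≤ -(1 / 4) := by
    rcases le_total (-1) (u (k + 1)) with h | h
    · linarith [le_wideStepDeriv h hk', wellDeriv_nonpos (u (k + 1))]
    · linarith [wideStepDeriv_nonneg (u (k + 1)), wellDeriv_le h]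
  nlinarith [h0 k]

/-- `step` is zero and flat at 0, whereas `wideStep` is not flat there. So at a zero coordinate the
link ahead exerts no force, and the link behind can do so only if its weight and the preceding
coordinate are both non-zero. -/
lemma slope_eq_zero {w u : ℕ → ℝ} {k : ℕ} (h0 : w k = 0 ∨ u k = 0) (h1 : u (k + 1) = 0) :
    slope w u k = 0 := by
  unfold slope
  rcases h0 with h0 | h0 <;> simp [h0, h1, stepDeriv_zero, step_zero, wellDeriv_zero]

lemma abs_slope_le {w u : ℕ → ℝ} {k : ℕ} (h0 : 0 ≤ w k) (hw : w k ≤ 1) (h1 : u (k + 1) = 0) :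
    |slope w u k| ≤ 1 / 2 := by
  unfold slope
  rw [h1, stepDeriv_zero, wellDeriv_zero, zero_mul, mul_zero, sub_zero, add_zero, abs_mul, abs_neg,
    abs_mul, abs_of_nonneg h0, abs_of_nonneg (step_nonneg _)]
  have e1 := abs_wideStepDeriv_le 0
  have e2 : step (u k) * |wideStepDeriv 0| ≤ 1 * (1 / 2) :=
    mul_le_mul (step_le_one _) e1 (abs_nonneg _) zero_le_one
  calc w k * (step (u k) * |wideStepDeriv 0|) ≤ 1 * (1 * (1 / 2)) :=
        mul_le_mul hw e2 (mul_nonneg (step_nonneg _) (abs_nonneg _)) zero_le_one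
    _ = 1 / 2 := by norm_num

/-! ### The chain on `ℝ^d`: gradient, smoothness, lower bound and large gradients. -/

variable {d : ℕ}

/-- The sequence `1, r x₀, r x₁, …, r x_{d-1}, 0, 0, …`. -/
def pad (r : ℝ) (x : E d) : ℕ → ℝ
  | 0 => 1
  | k + 1 => if h : k < d then r * x ⟨k, h⟩ else 0

@[simp] lemma pad_zero (r : ℝ) (x : E d) : pad r x 0 = 1 := rfl

lemma pad_succ (r : ℝ) (x : E d) (j : Fin d) : pad r x (j + 1) = r * x j := by
  simp [pad]

lemma pad_of_le (r : ℝ) (x : E d) {k : ℕ} (h : d ≤ k) : pad r x (k + 1) = 0 := by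
  simp [pad, not_lt.2 h]

/-- A chain of links between consecutive coordinates. -/
def chain (a r : ℝ) (w : ℕ → ℝ) (x : E d) : ℝ :=
  a * ∑ k ∈ Finset.range (d + 1),
    w k * (-(step (pad r x k) * wideStep (pad r x (k + 1))) + well (pad r x (k + 1)))

/-- The gradient of `chain`. -/
def chainGrad (a r : ℝ) (w : ℕ → ℝ) (x : E d) : E d :=
  WithLp.toLp 2 fun j => a * r * slope w (pad r x) j

lemma chainGrad_apply (a r : ℝ) (w : ℕ → ℝ) (x : E d) (j : Fin d) :
    chainGrad a r w x j = a * r * slope w (pad r x) j := rfl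

/-- The coordinate functional of index `k - 1`, which is zero for `k = 0` and for `k > d`. -/
def coordCLM (d : ℕ) : ℕ → E d →L[ℝ] ℝ
  | 0 => 0
  | k + 1 => if h : k < d then EuclideanSpace.proj ⟨k, h⟩ else 0

lemma hasFDerivAt_pad (r : ℝ) (x : E d) (k : ℕ) :
    HasFDerivAt (fun x => pad r x k) (r • coordCLM d k) x := by
  cases k with
  | zero => simpa [coordCLM] using hasFDerivAt_const (1 : ℝ) x
  | succ k =>
    by_cases h : k < d
    · simp only [pad, h, coordCLM, dite_true]
      exact ((EuclideanSpace.proj (𝕜 := ℝ) (⟨k, h⟩ : Fin d)).hasFDerivAt (x := x)).const_mul r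
    · simpa [pad, coordCLM, h] using hasFDerivAt_const (0 : ℝ) x

lemma hasGradientAt_chain (a r : ℝ) (w : ℕ → ℝ) (x : E d) :
    HasGradientAt (chain a r w) (chainGrad a r w x) x := by
  rw [hasGradientAt_iff_hasFDerivAt]
  have h1 (k : ℕ) := (hasDerivAt_step (pad r x k)).comp_hasFDerivAt x (hasFDerivAt_pad r x k)
  have h2 (k : ℕ) := (hasDerivAt_wideStep (pad r x k)).comp_hasFDerivAt x (hasFDerivAt_pad r x k)
  have h3 (k : ℕ) := (hasDerivAt_well (pad r x k)).comp_hasFDerivAt x (hasFDerivAt_pad r x k)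
  have h4 := (HasFDerivAt.fun_sum (u := Finset.range (d + 1)) fun k _ =>
    ((((h1 k).mul (h2 (k + 1))).neg.add (h3 (k + 1))).const_mul (w k))).const_mul a
  refine h4.congr_fderiv ?_
  ext v
  set V : ℕ → ℝ := fun k => coordCLM d k v with hV
  have e1 : (InnerProductSpace.toDual ℝ (E d)) (chainGrad a r w x) v =
      ∑ k ∈ Finset.range d, a * r * slope w (pad r x) k * V (k + 1) := by
    rw [InnerProductSpace.toDual_apply_apply, PiLp.inner_apply, Finset.sum_range]
    refine Finset.sum_congr rfl fun j _ => ?_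
    simp [chainGrad_apply, V, coordCLM]; ring
  rw [e1]
  set u := pad r x
  have e2 : ∀ k, (w k • ((-(step (u k) • (wideStepDeriv (u (k + 1)) • r • coordCLM d (k + 1)) +
      wideStep (u (k + 1)) • (stepDeriv (u k) • r • coordCLM d k))) +
        (wellDeriv (u (k + 1)) • r • coordCLM d (k + 1)))) v =
      r * (w k * (-(step (u k) * wideStepDeriv (u (k + 1))) + wellDeriv (u (k + 1))) * V (k + 1))
      - r * (w k * (stepDeriv (u k) * wideStep (u (k + 1))) * V k) := by
    intro k
    simp only [smul_apply, add_apply,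
      neg_apply, smul_eq_mul, V]; ring
  have e3 : V 0 = 0 := by simp [V, coordCLM]
  have e4 : V (d + 1) = 0 := by simp [V, coordCLM]
  rw [smul_apply, sum_apply]
  refine (congrArg (a • ·) (Finset.sum_congr rfl fun k _ => e2 k)).trans ?_
  -- Summation by parts collects the two links at each coordinate; the boundary terms vanish because
  -- both ends of the padded sequence are constant.
  rw [Finset.sum_sub_distrib, Finset.sum_range_succ, Finset.sum_range_succ', e3, e4]
  simp only [mul_zero, add_zero]
  rw [← Finset.sum_sub_distrib, smul_eq_mul, Finset.mul_sum]
  refine Finset.sum_congr rfl fun k _ => ?_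
  unfold slope; ring

lemma gradient_chain (a r : ℝ) (w : ℕ → ℝ) (x : E d) :
    gradient (chain a r w) x = chainGrad a r w x := (hasGradientAt_chain a r w x).gradient

lemma chainGrad_lipschitz {a r L : ℝ} (ha : 0 ≤ a) (hL : 8 * (a * r ^ 2) ≤ L)
    {w : ℕ → ℝ} (h0 : ∀ k, 0 ≤ w k) (h1 : ∀ k, w k ≤ 1) (x y : E d) :
    ‖chainGrad a r w x - chainGrad a r w y‖ ≤ L * ‖x - y‖ := by
  set D : ℕ → ℝ := fun k => (pad r x k - pad r y k) ^ 2 with hD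
  have hS : ∑ k ∈ Finset.range d, D (k + 1) = (r * ‖x - y‖) ^ 2 := by
    rw [mul_pow, EuclideanSpace.norm_sq_eq, Finset.sum_range, Finset.mul_sum]
    refine Finset.sum_congr rfl fun j _ => ?_
    simp only [D, pad_succ, PiLp.sub_apply, Real.norm_eq_abs, sq_abs]; ring
  -- The padded sequences agree at both ends, so shifting the index cannot increase the sum.
  have hD0 : D 0 = 0 := by simp [D]
  have hDd : D (d + 1) = 0 := by simp [D, pad_of_le]
  have hDn : ∀ k, 0 ≤ D k := fun k => sq_nonneg _
  have hS0 : ∑ k ∈ Finset.range d, D k ≤ (r * ‖x - y‖) ^ 2 := by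
    have e1 := Finset.sum_range_succ D d
    rw [Finset.sum_range_succ'] at e1
    linarith [hDn d]
  have hS2 : ∑ k ∈ Finset.range d, D (k + 2) ≤ (r * ‖x - y‖) ^ 2 := by
    have e1 := Finset.sum_range_succ (fun k => D (k + 1)) d
    rw [Finset.sum_range_succ'] at e1
    linarith [hDn (0 + 1)]
  have hsq : ‖chainGrad a r w x - chainGrad a r w y‖ ^ 2 ≤ (8 * (a * r ^ 2) * ‖x - y‖) ^ 2 := by
    rw [EuclideanSpace.norm_sq_eq]
    calc ∑ j, ‖(chainGrad a r w x - chainGrad a r w y) j‖ ^ 2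
        = ∑ j : Fin d, (a * r) ^ 2 * |slope w (pad r x) j - slope w (pad r y) j| ^ 2 := by
          refine Finset.sum_congr rfl fun j _ => ?_
          simp only [PiLp.sub_apply, chainGrad_apply, Real.norm_eq_abs, sq_abs]; ring
      _ ≤ ∑ j : Fin d, (a * r) ^ 2 * (8 * (D j + 6 * D (j + 1) + D (j + 2))) := by
          refine Finset.sum_le_sum fun j _ => ?_
          gcongr
          refine (pow_le_pow_left₀ (abs_nonneg _) (slope_lipschitz h0 h1 _ _ _) 2).trans ?_
          simp only [D]
          rw [← sq_abs (pad r x j - _), ← sq_abs (pad r x (j + 1) - _),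
            ← sq_abs (pad r x (j + 2) - _)]
          set p := |pad r x j - pad r y j|
          set q := |pad r x (j + 1) - pad r y (j + 1)|
          set s := |pad r x (j + 2) - pad r y (j + 2)|
          -- Cauchy–Schwarz with weights 1, 6, 1 of total 8. Summed over coordinates it gives the
          -- factor 8 · 8 = 8².
          nlinarith [sq_nonneg (p - q), sq_nonneg (q - s), sq_nonneg (p - s)]
      _ = (a * r) ^ 2 * (8 * (∑ k ∈ Finset.range d, D k + 6 * ∑ k ∈ Finset.range d, D (k + 1) +
            ∑ k ∈ Finset.range d, D (k + 2))) := by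
          rw [← Finset.mul_sum, ← Finset.mul_sum, Finset.sum_add_distrib, Finset.sum_add_distrib,
            ← Finset.mul_sum, Finset.sum_range, Finset.sum_range, Finset.sum_range]
      _ ≤ (a * r) ^ 2 * (8 * ((r * ‖x - y‖) ^ 2 + 6 * (r * ‖x - y‖) ^ 2 + (r * ‖x - y‖) ^ 2)) := by
          gcongr
          exact hS.le
      _ = (8 * (a * r ^ 2) * ‖x - y‖) ^ 2 := by ring
  refine (le_of_sq_le_sq hsq (by positivity)).trans ?_
  gcongr

lemma chain_zero_le {a r : ℝ} (ha : 0 ≤ a) {w : ℕ → ℝ} (h0 : ∀ k, 0 ≤ w k) :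
    chain a r w (0 : E d) ≤ 0 := by
  refine mul_nonpos_of_nonneg_of_nonpos ha (Finset.sum_nonpos fun k _ => ?_)
  have : pad r (0 : E d) (k + 1) = 0 := by simp [pad]
  rw [this, well_zero]
  have := mul_nonneg (step_nonneg (pad r (0 : E d) k)) (wideStep_nonneg 0)
  nlinarith [h0 k]

lemma le_chain {a r : ℝ} (ha : 0 ≤ a) {w : ℕ → ℝ} (h0 : ∀ k, 0 ≤ w k) (h1 : ∀ k, w k ≤ 1)
    (x : E d) : -(a * (d + 1)) ≤ chain a r w x := by
  have : ∑ k ∈ Finset.range (d + 1), (-1 : ℝ) ≤ ∑ k ∈ Finset.range (d + 1),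
      w k * (-(step (pad r x k) * wideStep (pad r x (k + 1))) + well (pad r x (k + 1))) := by
    refine Finset.sum_le_sum fun k _ => ?_
    have e1 : step (pad r x k) * wideStep (pad r x (k + 1)) ≤ 1 :=
      mul_le_one₀ (step_le_one _) (wideStep_nonneg _) (wideStep_le_one _)
    nlinarith [h0 k, h1 k, well_nonneg (pad r x (k + 1)),
      mul_nonneg (h0 k) (well_nonneg (pad r x (k + 1)))]
  rw [Finset.sum_const, Finset.card_range, nsmul_eq_mul] at this
  push_cast at this
  unfold chain
  nlinarith

lemma le_norm_chainGrad {a r b : ℝ} (ha : 0 ≤ a) (hr : 0 ≤ r) (hb : 0 ≤ b) {w : ℕ → ℝ}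
    (h0 : ∀ k, b ≤ w k) (x : E d) (j : Fin d) (hj : x j = 0) :
    a * r * (b / 4) ≤ ‖chainGrad a r w x‖ := by
  -- At the first drop below 1 the preceding entry is at least 1, by minimality or because the
  -- padding starts with 1. The partial derivative there is large.
  have hex : ∃ k, k < d ∧ pad r x (k + 1) < 1 := ⟨j, j.2, by rw [pad_succ, hj]; simp⟩
  classical
  obtain ⟨hk, hk1⟩ := Nat.find_spec hex
  set k := Nat.find hex with hkdef
  have hk0 : 1 ≤ pad r x k := by
    rcases hk' : k with _ | m
    · simp
    · by_contra hlt
      exact Nat.find_min hex (m := m) (by omega) ⟨by omega, not_le.1 hlt⟩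
  have h2 := slope_le hb h0 hk0 hk1.le
  calc a * r * (b / 4) ≤ ‖chainGrad a r w x ⟨k, hk⟩‖ := by
        rw [chainGrad_apply, Real.norm_eq_abs, abs_mul, abs_of_nonneg (mul_nonneg ha hr)]
        gcongr
        rw [le_abs]; right; linarith
    _ ≤ _ := PiLp.norm_apply_le _ _

variable {n : ℕ}

/-! ### The average of chains -/

/-- A chain is linear in its weights, so the global objective is again a chain and inherits all the
estimates. -/
lemma average_chain (a r : ℝ) (w : Fin n → ℕ → ℝ) :
    average (fun i => chain (d := d) a r (w i)) = chain a r fun k => (∑ i, w i k) / n := by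
  funext x
  unfold average chain
  rw [← Finset.mul_sum, Finset.sum_comm, mul_div_assoc, Finset.sum_div]
  congr 1
  refine Finset.sum_congr rfl fun k _ => ?_
  rw [← Finset.sum_mul]; ring

lemma smoothClass_chain {a r Δ L : ℝ} (ha : 0 ≤ a) (hL : 8 * (a * r ^ 2) ≤ L)
    (hΔ : a * (d + 1) ≤ Δ) {w : Fin n → ℕ → ℝ} (h0 : ∀ i k, 0 ≤ w i k)
    (h1 : ∀ i k, w i k ≤ 1) : SmoothClass Δ L (0 : E d) (fun i => chain a r (w i)) := by
  have g0 : ∀ k, 0 ≤ (∑ i, w i k) / n := fun k =>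
    div_nonneg (Finset.sum_nonneg fun i _ => h0 i k) (Nat.cast_nonneg n)
  have g1 : ∀ k, (∑ i, w i k) / n ≤ 1 := fun k =>
    div_le_one_of_le₀ ((Finset.sum_le_sum fun i _ => h1 i k).trans (by simp)) (Nat.cast_nonneg n)
  refine ⟨fun i x => (hasGradientAt_chain a r (w i) x).differentiableAt, fun i x y => ?_, ?_, ?_⟩
  · rw [gradient_chain, gradient_chain]
    exact chainGrad_lipschitz ha hL (h0 i) (h1 i) x y
  · rw [average_chain]
    exact ⟨-(a * (d + 1)), by rintro _ ⟨x, rfl⟩; exact le_chain ha g0 g1 x⟩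
  · rw [average_chain]
    have e1 := chain_zero_le (d := d) (r := r) ha g0
    have e2 := le_ciInf (le_chain (d := d) (r := r) ha g0 g1)
    linarith

/-! ### Supports -/

/-- Only the first `m` coordinates of `v` may be non-zero. -/
def Below (m : ℕ) (v : E d) : Prop := ∀ k : Fin d, m ≤ k → v k = 0

lemma Below.mono {m m' : ℕ} {v : E d} (h : Below m v) (hm : m ≤ m') : Below m' v :=
  fun k hk => h k (hm.trans hk)

lemma below_zero (m : ℕ) : Below m (0 : E d) := fun _ _ => rfl

lemma pad_eq_zero {r : ℝ} {x : E d} {j : ℕ} (h : ∀ k : Fin d, (k : ℕ) = j → x k = 0) :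
    pad r x (j + 1) = 0 := by
  by_cases hj : j < d
  · rw [show j = ((⟨j, hj⟩ : Fin d) : ℕ) from rfl, pad_succ, h ⟨j, hj⟩ rfl, mul_zero]
  · exact pad_of_le r x (not_lt.1 hj)

/-- A gradient adds at most the index `m`, through link `m`; where that link has weight 0 it adds
nothing. -/
lemma below_chainGrad {m m' : ℕ} {x : E d} (hx : Below m x) (hm : m ≤ m') {w : ℕ → ℝ}
    (hw : m' = m → w m = 0) (a r : ℝ) : Below m' (chainGrad a r w x) := by
  intro j hj
  rw [chainGrad_apply, slope_eq_zero, mul_zero]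
  · rcases eq_or_lt_of_le (hm.trans hj) with h | h
    · left
      rw [← h]
      exact hw (by omega)
    · right
      obtain ⟨l, hl⟩ : ∃ l, (j : ℕ) = l + 1 := ⟨j - 1, by omega⟩
      rw [hl]
      exact pad_eq_zero fun k hk => hx k (by omega)
  · exact pad_eq_zero fun k hk => hx k (by omega)

lemma apply_eq_zero_of_mem_span {s : Set (E d)} {x : E d} (hx : x ∈ Submodule.span ℝ s)
    {k : Fin d} (hs : ∀ v ∈ s, v k = 0) : x k = 0 := by
  induction hx using Submodule.span_induction with
  | mem v hv => exact hs v hv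
  | zero => rfl
  | add u v _ _ hu hv => simp [hu, hv]
  | smul c v _ hv => simp [hv]

/-- Progress of a zero-respecting run, when the answers of the oracles and the compressed messages
obey bounds on the supports. -/
lemma ZeroRespecting.progress {A : Algorithm.{u} n d} {O : Fin n → Oracle d} {C : Compressors n d}
    {ω : Outcome A O C} {T : ℕ} (hz : ZeroRespecting A T ω) (hstart : ∀ i, xAt A ω i 0 = 0)
    {B G : ℕ → Fin n → ℕ} {S : ℕ → ℕ} (hS : Monotone S) (hBG : ∀ t i, B t i ≤ G t i)
    (hGB : ∀ t i, G t i ≤ B (t + 1) i) (hSB : ∀ t i, S t ≤ B t i)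
    (hg : ∀ t < T, ∀ i, Below (B t i) (yAt A ω i t) → Below (G t i) (gAt A ω i t))
    (hm : ∀ t < T, ∀ i, (∀ v ∈ targetAt A ω i t, Below (G t i) v) →
      ∀ v ∈ upAt A ω i t, Below (S (t + 1)) v) :
    ∀ t ≤ T, (∀ i, ∀ s ≤ t, Below (B t i) (xAt A ω i s)) ∧
      (∀ i, ∀ s < t, Below (B t i) (gAt A ω i s)) ∧
      (∀ i, ∀ s < t, ∀ v ∈ upAt A ω i s, Below (S t) v) ∧
      (∀ s < t, ∀ v ∈ downAt A ω s, Below (S t) v) := by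
  -- `B t i` bounds what worker `i` knows before phase `t`, `G t i` what it knows once the oracle
  -- has answered, and `S t` what has passed through the server before the phase. Supports grow in
  -- the order query, answer, message, broadcast, model.
  intro t
  induction t with
  | zero =>
    intro _
    refine ⟨fun i s hs => ?_, by simp, by simp, by simp⟩
    rw [Nat.le_zero.1 hs, hstart]; exact below_zero _
  | succ t ih =>
    intro ht
    obtain ⟨hx, hgr, hu, hd⟩ := ih (by omega)
    have htT : t < T := ht
    have hy : ∀ i, Below (B t i) (yAt A ω i t) := by
      intro i k hk
      by_contra hne
      rcases hz.query t htT i k hne with ⟨s, hs, h⟩ | ⟨s, hs, h⟩ | ⟨s, hs, v, hv, h⟩ |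
        ⟨s, hs, v, hv, h⟩
      · exact h (hx i s hs k hk)
      · exact h (hgr i s hs k hk)
      · exact h (hd s hs v hv k ((hSB t i).trans hk))
      · exact h (hu i s hs v hv k ((hSB t i).trans hk))
    have hg' : ∀ i, ∀ s ≤ t, Below (G t i) (gAt A ω i s) := by
      intro i s hs
      rcases eq_or_lt_of_le hs with rfl | hs
      · exact hg s htT i (hy i)
      · exact (hgr i s hs).mono (hBG t i)
    have htar : ∀ i, ∀ v ∈ targetAt A ω i t, Below (G t i) v := by
      intro i u hu' k hk
      by_contra hne
      have hk' := (hBG t i).trans hk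
      rcases hz.send t htT i k u hu' hne with ⟨s, hs, h⟩ | ⟨s, hs, h⟩ | ⟨s, hs, v, hv, h⟩ |
        ⟨s, hs, v, hv, h⟩
      · exact h (hx i s hs k hk')
      · exact h (hg' i s hs k hk)
      · exact h (hd s hs v hv k ((hSB t i).trans hk'))
      · exact h (hu i s hs v hv k ((hSB t i).trans hk'))
    have hu' : ∀ i, ∀ s ≤ t, ∀ v ∈ upAt A ω i s, Below (S (t + 1)) v := by
      intro i s hs
      rcases eq_or_lt_of_le hs with rfl | hs
      · exact hm s htT i (htar i)
      · exact fun v hv => (hu i s hs v hv).mono (hS t.le_succ)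
    have hd' : ∀ s ≤ t, ∀ v ∈ downAt A ω s, Below (S (t + 1)) v := by
      intro s hs
      rcases eq_or_lt_of_le hs with rfl | hs
      · intro v hv k hk
        by_contra hne
        rcases hz.broadcast s htT k v hv hne with ⟨q, hq, i, v', hv', h⟩ | ⟨q, hq, v', hv', h⟩
        · exact h (hu' i q hq v' hv' k hk)
        · exact h (hd q hq v' hv' k ((hS s.le_succ).trans hk))
      · exact fun v hv => (hd s hs v hv).mono (hS t.le_succ)
    refine ⟨fun i s hs => ?_, fun i s hs => (hg' i s (by omega)).mono (hGB t i),
      fun i s hs => hu' i s (by omega), fun s hs => hd' s (by omega)⟩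
    rcases Nat.lt_succ_iff_lt_or_eq.1 (Nat.lt_succ_of_le hs) with hs | rfl
    · exact (hx i s (by omega)).mono ((hBG t i).trans (hGB t i))
    · intro k hk
      by_contra hne
      rcases hz.model t htT i k hne with ⟨s, hs, h⟩ | ⟨s, hs, h⟩ | ⟨s, hs, v, hv, h⟩ |
        ⟨s, hs, v, hv, h⟩
      · exact h (hx i s hs k (((hBG t i).trans (hGB t i)).trans hk))
      · exact h (hg' i s hs k ((hGB t i).trans hk))
      · exact h (hd' s hs v hv k ((hSB _ i).trans hk))
      · exact h (hu' i s hs v hv k ((hSB _ i).trans hk))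

/-! ### Probability -/

lemma measurePreserving_rand (A : Algorithm.{u} n d) (O : Fin n → Oracle d) (C : Compressors n d)
    (r : ℕ) : MeasurePreserving (fun ω : Outcome A O C => ω.2.2 r) (outcomeLaw A O C) C.law :=
  (measurePreserving_eval_infinitePi (fun _ : ℕ => C.law) r).comp
    (measurePreserving_snd.comp measurePreserving_snd)

lemma measurePreserving_noise (A : Algorithm.{u} n d) (O : Fin n → Oracle d) (C : Compressors n d)
    (q : Fin n × ℕ) :
    MeasurePreserving (fun ω : Outcome A O C => ω.2.1 q) (outcomeLaw A O C) (O q.1).law :=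
  (measurePreserving_eval_infinitePi (fun p : Fin n × ℕ => (O p.1).law) q).comp
    (measurePreserving_fst.comp measurePreserving_snd)

instance (A : Algorithm.{u} n d) (O : Fin n → Oracle d) (C : Compressors n d) :
    IsProbabilityMeasure (outcomeLaw A O C) := by unfold outcomeLaw; infer_instance

lemma measurableSet_le_card_filter {Ω ι : Type*} [MeasurableSpace Ω] (s : Finset ι)
    (P : ι → Ω → Prop) [∀ ω, DecidablePred fun i => P i ω] (hP : ∀ i, MeasurableSet {ω | P i ω})
    (m : ℕ) : MeasurableSet {ω | m ≤ (s.filter fun i => P i ω).card} := by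
  classical
  have : Measurable fun ω => (s.filter fun i => P i ω).card := by
    simp only [Finset.card_filter]
    exact Finset.measurable_fun_sum s fun i _ =>
      Measurable.ite (hP i) measurable_const measurable_const
  exact this measurableSet_Ici

/-- Markov's inequality for the number of events that occur; only their individual probabilities
enter. -/
lemma measure_le_card_filter_le_half {Ω ι : Type*} [MeasurableSpace Ω] (μ : Measure Ω)
    (s : Finset ι) (P : ι → Ω → Prop) [∀ ω, DecidablePred fun i => P i ω]
    (hP : ∀ i, MeasurableSet {ω | P i ω}) {p : ℝ} (hp : ∀ i, μ {ω | P i ω} ≤ ENNReal.ofReal p)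
    {m : ℕ} (hm : 0 < m) (h : 2 * (s.card * p) ≤ m) :
    μ {ω | m ≤ (s.filter fun i => P i ω).card} ≤ 1 / 2 := by
  classical
  have hcard : ∀ ω, (((s.filter fun i => P i ω).card : ℕ) : ENNReal) =
      ∑ i ∈ s, {ω | P i ω}.indicator 1 ω := by
    intro ω
    rw [Finset.card_filter, Nat.cast_sum]
    exact Finset.sum_congr rfl fun i _ => by by_cases h : P i ω <;> simp [h]
  have h1 : ∫⁻ ω, (((s.filter fun i => P i ω).card : ℕ) : ENNReal) ∂μ ≤
      ENNReal.ofReal (s.card * p) := by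
    simp only [hcard]
    rw [lintegral_finsetSum _ fun i _ => (measurable_one.indicator (hP i))]
    simp only [lintegral_indicator_one (hP _)]
    calc _ ≤ ∑ _i ∈ s, ENNReal.ofReal p := Finset.sum_le_sum fun i _ => hp i
      _ = _ := by
        rw [Finset.sum_const, nsmul_eq_mul, ENNReal.ofReal_mul (Nat.cast_nonneg _),
          ENNReal.ofReal_natCast]
  have h2 : (m : ENNReal) * μ {ω | m ≤ (s.filter fun i => P i ω).card} ≤
      ENNReal.ofReal (s.card * p) := by
    refine le_trans ?_ h1
    have := mul_meas_ge_le_lintegral₀ (μ := μ)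
      (f := fun ω => (((s.filter fun i => P i ω).card : ℕ) : ENNReal))
      (by simp only [hcard]
          exact (Finset.measurable_fun_sum s fun i _ =>
            measurable_one.indicator (hP i)).aemeasurable) (m : ENNReal)
    simpa using this
  have hm0 : (m : ENNReal) ≠ 0 := by exact_mod_cast hm.ne'
  have h3 : ENNReal.ofReal (s.card * p) ≤ (m : ENNReal) * (1 / 2) := by
    rw [show (m : ENNReal) * (1 / 2) = ENNReal.ofReal (m / 2) by
      rw [ENNReal.ofReal_div_of_pos two_pos, ENNReal.ofReal_natCast, ENNReal.ofReal_ofNat,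
        mul_one_div]]
    exact ENNReal.ofReal_le_ofReal (by linarith)
  exact (ENNReal.mul_le_mul_iff_right hm0 (ENNReal.natCast_ne_top m)).1 (h2.trans h3)

/-- Comparison with an indicator works for arbitrary `F`, so outputs of the algorithm need not be
measurable. -/
lemma ofReal_half_le_lintegral {Ω : Type*} [MeasurableSpace Ω] (μ : Measure Ω)
    [IsProbabilityMeasure μ] {F : Ω → ENNReal} {bad : Set Ω} (hbad : MeasurableSet bad)
    (hμ : μ bad ≤ 1 / 2) {c : ℝ} (h : ∀ᵐ ω ∂μ, ω ∉ bad → ENNReal.ofReal c ≤ F ω) :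
    ENNReal.ofReal (c / 2) ≤ ∫⁻ ω, F ω ∂μ := by
  have h1 : 1 / 2 ≤ μ badᶜ := by
    rw [prob_compl_eq_one_sub hbad]
    calc (1 / 2 : ENNReal) = 1 - 1 / 2 := by simp
      _ ≤ _ := tsub_le_tsub_left hμ 1
  calc ENNReal.ofReal (c / 2) = ENNReal.ofReal c * (1 / 2) := by
        rw [ENNReal.ofReal_div_of_pos two_pos, ENNReal.ofReal_ofNat, mul_one_div]
    _ ≤ ENNReal.ofReal c * μ badᶜ := by gcongr
    _ = ∫⁻ ω, badᶜ.indicator (fun _ => ENNReal.ofReal c) ω ∂μ :=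
        (lintegral_indicator_const hbad.compl _).symm
    _ ≤ _ := by
        refine lintegral_mono_ae (h.mono fun ω hω => ?_)
        by_cases hb : ω ∈ bad
        · simp [hb]
        · simpa [hb] using hω hb

/-- A biased coin. -/
def coin (p : ℝ) : Measure Bool :=
  ENNReal.ofReal p • Measure.dirac true + ENNReal.ofReal (1 - p) • Measure.dirac false

lemma isProbabilityMeasure_coin {p : ℝ} (hp : p ∈ Set.Icc (0 : ℝ) 1) :
    IsProbabilityMeasure (coin p) := by
  constructor
  simp only [coin, Measure.coe_add, Measure.coe_smul, Pi.add_apply, Pi.smul_apply, measure_univ,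
    smul_eq_mul, mul_one]
  rw [← ENNReal.ofReal_add hp.1 (sub_nonneg.2 hp.2)]; simp

lemma coin_singleton_true (p : ℝ) : coin p {true} = ENNReal.ofReal p := by
  simp [coin]

lemma lintegral_coin (p : ℝ) (g : Bool → ENNReal) :
    ∫⁻ z, g z ∂coin p = ENNReal.ofReal p * g true + ENNReal.ofReal (1 - p) * g false := by
  simp [coin, lintegral_add_measure, lintegral_smul_measure]

lemma integral_coin {p : ℝ} (hp : p ∈ Set.Icc (0 : ℝ) 1) (g : Bool → E d) :
    ∫ z, g z ∂coin p = p • g true + (1 - p) • g false := by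
  have := isProbabilityMeasure_coin hp
  rw [integral_fintype (Integrable.of_finite)]
  simp [coin, Measure.real, hp.1, sub_nonneg.2 hp.2]

/-! ### Oracles and compressors -/

lemma continuous_gradient_chain (a r : ℝ) {w : ℕ → ℝ} (ha : 0 ≤ a) (h0 : ∀ k, 0 ≤ w k)
    (h1 : ∀ k, w k ≤ 1) : Continuous (gradient (chain (d := d) a r w)) := by
  have := LipschitzWith.of_dist_le_mul (K := (8 * (a * r ^ 2)).toNNReal)
    (f := chainGrad (d := d) a r w) fun x y => by
      rw [dist_eq_norm, dist_eq_norm, Real.coe_toNNReal _ (by positivity)]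
      exact chainGrad_lipschitz ha le_rfl h0 h1 x y
  rw [show gradient (chain (d := d) a r w) = chainGrad a r w from funext (gradient_chain a r w)]
  exact this.continuous

/-- The oracle without noise. -/
def exactOracle (f : E d → ℝ) : Oracle d where
  Noise := Unit
  law := Measure.dirac ()
  eval := fun x _ => gradient f x

lemma exactOracle_inClass {f : E d → ℝ} (hf : Measurable (gradient f)) (σ : ℝ) :
    (exactOracle f).InClass σ f where
  measurable := hf.comp measurable_fst
  integrable x := integrable_const (μ := Measure.dirac ()) (gradient f x)
  unbiased x := integral_dirac (fun _ : Unit => gradient f x) ()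
  variance x :=
    (lintegral_dirac () (fun _ : Unit => ‖gradient f x - gradient f x‖ₑ ^ 2)).trans_le (by simp)

open Classical in
/-- The oracle that multiplies every partial derivative beyond the support of the query point by
the same Bernoulli variable of mean one. -/
def bernoulliOracle (p : ℝ) (hp : p ∈ Set.Icc (0 : ℝ) 1) (f : E d → ℝ) : Oracle d where
  Noise := Bool
  law := coin p
  prob := isProbabilityMeasure_coin hp
  eval := fun x z => WithLp.toLp 2 fun j =>
    gradient f x j * if ∀ k : Fin d, j ≤ k → x k = 0 then (if z then p⁻¹ else 0) else 1

lemma bernoulliOracle_eval_apply {p : ℝ} {hp : p ∈ Set.Icc (0 : ℝ) 1} {f : E d → ℝ} (x : E d)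
    (z : Bool) (j : Fin d) [Decidable (∀ k : Fin d, j ≤ k → x k = 0)] :
    (bernoulliOracle p hp f).eval x z j =
      gradient f x j * if ∀ k : Fin d, j ≤ k → x k = 0 then (if z then p⁻¹ else 0) else 1 := by
  simp only [bernoulliOracle]; congr

lemma bernoulliOracle_eval_eq_zero {p : ℝ} {hp : p ∈ Set.Icc (0 : ℝ) 1} {f : E d → ℝ} {x : E d}
    {z : Bool} {j : Fin d} (h : gradient f x j = 0 ∨ Below j x ∧ z ≠ true) :
    (bernoulliOracle p hp f).eval x z j = 0 := by
  classical
  rw [bernoulliOracle_eval_apply]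
  rcases h with h | ⟨h, hz⟩
  · rw [h, zero_mul]
  · rw [if_pos fun (k : Fin d) (hk : j ≤ k) => h k hk, if_neg hz, mul_zero]

lemma measurable_bernoulliOracle {p : ℝ} {hp : p ∈ Set.Icc (0 : ℝ) 1} {f : E d → ℝ}
    (hf : Measurable (gradient f)) :
    Measurable fun q : E d × Bool => (bernoulliOracle p hp f).eval q.1 q.2 := by
  classical
  have hc : ∀ j : Fin d, Measurable fun x : E d => x j := fun j =>
    (EuclideanSpace.proj (𝕜 := ℝ) j).continuous.measurable
  refine (WithLp.measurable_toLp 2 (Fin d → ℝ)).comp (measurable_pi_lambda _ fun j => ?_)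
  refine ((hc j).comp (hf.comp measurable_fst)).mul (Measurable.ite ?_ ?_ measurable_const)
  · rw [show {q : E d × Bool | ∀ k : Fin d, j ≤ k → q.1 k = 0} =
      ⋂ k : Fin d, ⋂ _ : j ≤ k, {q : E d × Bool | q.1 k = 0} by ext; simp]
    exact MeasurableSet.iInter fun k => MeasurableSet.iInter fun _ =>
      ((hc k).comp measurable_fst) (measurableSet_singleton 0)
  · exact (measurable_of_countable fun z : Bool => if z then p⁻¹ else (0 : ℝ)).comp measurable_snd

/-- Beyond the support only the first partial derivative can be non-zero, so the noise acts on a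
single entry of size at most |ar|/2, whatever the dimension. -/
lemma sum_sq_chainGrad_le {a r : ℝ} {w : ℕ → ℝ} (h0 : ∀ k, 0 ≤ w k) (h1 : ∀ k, w k ≤ 1)
    (x : E d) (s : Finset (Fin d)) (hs : ∀ j ∈ s, ∀ k : Fin d, j ≤ k → x k = 0) :
    ∑ j ∈ s, chainGrad a r w x j ^ 2 ≤ (a * r / 2) ^ 2 := by
  classical
  rcases s.eq_empty_or_nonempty with rfl | hne
  · simpa using sq_nonneg (a * r / 2)
  have hmem := s.min'_mem hne
  set m := s.min' hne with hm
  rw [Finset.sum_eq_single_of_mem m hmem]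
  · have hp : pad r x (m + 1) = 0 := by rw [pad_succ, hs m hmem m le_rfl, mul_zero]
    have := abs_slope_le (h0 m) (h1 m) hp
    rw [chainGrad_apply, div_eq_mul_one_div, mul_pow _ (slope _ _ _), mul_pow _ (1 / 2 : ℝ)]
    refine mul_le_mul_of_nonneg_left ?_ (sq_nonneg _)
    rw [← sq_abs (slope _ _ _)]
    exact pow_le_pow_left₀ (abs_nonneg _) this 2
  · intro j hj hjm
    have hlt : m < j := lt_of_le_of_ne (s.min'_le j hj) (Ne.symm hjm)
    have := below_chainGrad (m := m) (m' := m + 1) (w := w) (x := x)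
      (fun k hk => hs m hmem k hk) (Nat.le_succ _) (by omega) a r
    rw [this j (by exact_mod_cast hlt)]; simp

/-- Multiplying an entry g by Z/p, with Z a coin of bias p, keeps the mean and has variance
g²(1-p)/p. -/
lemma bernoulliOracle_inClass {p : ℝ} (hp : p ∈ Set.Icc (0 : ℝ) 1) (hp0 : 0 < p) {a r σ : ℝ}
    (ha : 0 ≤ a) {w : ℕ → ℝ} (h0 : ∀ k, 0 ≤ w k) (h1 : ∀ k, w k ≤ 1)
    (hσ : (a * r / 2) ^ 2 ≤ p * σ ^ 2) :
    (bernoulliOracle (d := d) p hp (chain a r w)).InClass σ (chain a r w) where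
  measurable := measurable_bernoulliOracle (continuous_gradient_chain a r ha h0 h1).measurable
  integrable x := by
    have := isProbabilityMeasure_coin hp
    exact Integrable.of_finite (μ := coin p)
  unbiased x := by
    classical
    refine (integral_coin hp _).trans ?_
    ext j
    simp only [PiLp.add_apply, PiLp.smul_apply, smul_eq_mul, bernoulliOracle_eval_apply, if_true]
    by_cases h : ∀ k : Fin d, j ≤ k → x k = 0
    · simp only [if_pos h, Bool.false_eq_true, if_false]
      field_simp
      ring
    · simp only [if_neg h]
      ring
  variance x := by
    classical
    set O := bernoulliOracle (d := d) p hp (chain a r w) with hO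
    set g := gradient (chain (d := d) a r w) x with hg
    set s : Finset (Fin d) := Finset.univ.filter fun j => ∀ k : Fin d, j ≤ k → x k = 0 with hs
    have hS := sum_sq_chainGrad_le (a := a) (r := r) h0 h1 x s
      (fun j hj => (Finset.mem_filter.1 hj).2)
    rw [← gradient_chain, ← hg] at hS
    have key : ∀ z : Bool, ‖O.eval x z - g‖ ^ 2 =
        (∑ j ∈ s, g j ^ 2) * ((if z then p⁻¹ else 0) - 1) ^ 2 := by
      intro z
      rw [EuclideanSpace.norm_sq_eq, Finset.sum_mul, hs, Finset.sum_filter]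
      refine Finset.sum_congr rfl fun j _ => ?_
      rw [PiLp.sub_apply, bernoulliOracle_eval_apply, Real.norm_eq_abs, sq_abs, ← hg]
      split_ifs with h <;> ring
    have key' : ∀ z : Bool, ‖O.eval x z - g‖ₑ ^ 2 =
        ENNReal.ofReal ((∑ j ∈ s, g j ^ 2) * ((if z then p⁻¹ else 0) - 1) ^ 2) := by
      intro z
      rw [← key, ENNReal.ofReal_pow (norm_nonneg _), ofReal_norm]
    refine (lintegral_coin p fun z => ‖O.eval x z - g‖ₑ ^ 2).trans_le ?_
    have hS0 : 0 ≤ ∑ j ∈ s, g j ^ 2 := Finset.sum_nonneg fun j _ => sq_nonneg _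
    have hp1 := sub_nonneg.2 hp.2
    rw [key', key', ← ENNReal.ofReal_mul hp.1, ← ENNReal.ofReal_mul hp1,
      ← ENNReal.ofReal_add (by positivity) (by positivity)]
    refine ENNReal.ofReal_le_ofReal ?_
    simp only [if_true, Bool.false_eq_true, if_false]
    set Q := ∑ j ∈ s, g j ^ 2
    have e1 : p * (Q * (p⁻¹ - 1) ^ 2) + (1 - p) * (Q * (0 - 1) ^ 2) = Q * (1 - p) / p := by
      field_simp; ring
    rw [e1, div_le_iff₀ hp0]
    nlinarith [hp.1]

/-- Lossless communication. -/
def losslessCompressors (n d : ℕ) : Compressors n d where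
  Rand := Unit
  law := Measure.dirac ()
  compress := fun _ _ x => x

lemma losslessCompressors_contractive (δ : ℝ) :
    (losslessCompressors n d).Contractive δ where
  measurable _ := measurable_snd
  contract i x :=
    (lintegral_dirac () (fun _ : Unit => ‖x - x‖ₑ ^ 2)).trans_le (by simp)

/-- In every round, either all messages arrive intact or all of them are erased. -/
def erasureCompressors (n d : ℕ) (δ : ℝ) (hδ : δ ∈ Set.Icc (0 : ℝ) 1) : Compressors n d where
  Rand := Bool
  law := coin δ
  prob := isProbabilityMeasure_coin hδ
  compress := fun _ θ x => if θ then x else 0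

lemma erasureCompressors_contractive {δ : ℝ} (hδ : δ ∈ Set.Icc (0 : ℝ) 1) :
    (erasureCompressors n d δ hδ).Contractive δ where
  measurable _ := by
    refine Measurable.ite ?_ measurable_snd measurable_const
    exact measurable_fst (α := Bool) (measurableSet_singleton true)
  contract i x := by
    refine (lintegral_coin δ _).trans_le ?_
    simp only [erasureCompressors, if_true, sub_self, enorm_zero, Bool.false_eq_true, if_false,
      zero_sub, enorm_neg]
    rw [ENNReal.ofReal_mul (sub_nonneg.2 hδ.2), ENNReal.ofReal_pow (norm_nonneg _),
      ofReal_norm]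
    simp

/-! ### From progress to a lower bound -/

/-- If with probability at least one half no local model reaches the last coordinate, then every
output has a large expected squared gradient. -/
lemma lintegral_gradient_ge {A : Algorithm.{u} n d} {O : Fin n → Oracle d} {C : Compressors n d}
    {T : ℕ} {a r b : ℝ} (ha : 0 ≤ a) (hr : 0 ≤ r) (hb : 0 ≤ b) {w : Fin n → ℕ → ℝ}
    (hw : ∀ k, b ≤ (∑ i, w i k) / n) (j : Fin d) {xhat : Outcome A O C → E d}
    (hx : IsOutput A O C T xhat) {bad : Set (Outcome A O C)} (hbad : MeasurableSet bad)
    (hμ : outcomeLaw A O C bad ≤ 1 / 2)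
    (h : ∀ᵐ ω ∂(outcomeLaw A O C), ω ∉ bad → ∀ i, ∀ s ≤ T, xAt A ω i s j = 0) :
    ENNReal.ofReal ((a * r * (b / 4)) ^ 2 / 2) ≤
      ∫⁻ ω, ‖gradient (average fun i => chain a r (w i)) (xhat ω)‖ₑ ^ 2 ∂(outcomeLaw A O C) := by
  refine ofReal_half_le_lintegral _ hbad hμ ?_
  filter_upwards [hx, h] with ω h1 h2 hω
  have h3 : xhat ω j = 0 := apply_eq_zero_of_mem_span h1 <| by
    rintro _ ⟨i, s, hs, rfl⟩
    exact h2 hω i s hs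
  rw [average_chain, gradient_chain, ← ofReal_norm, ← ENNReal.ofReal_pow (norm_nonneg _)]
  refine ENNReal.ofReal_le_ofReal ?_
  gcongr
  exact le_norm_chainGrad ha hr hb hw _ j h3

/-! ### The two hard instances -/

/-- Here `D` is the number of links, `Δ / D` the height `a` and the square root the scale `r`.
Smoothness is exhausted, and the squared gradient is left at order LΔ/D. -/
lemma scale_identities {Δ L : ℝ} (hΔ : 0 < Δ) (hL : 0 < L) {D : ℝ} (hD : 0 < D) (c : ℝ) :
    8 * (Δ / D * √(L * D / (8 * Δ)) ^ 2) = L ∧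
      (Δ / D * √(L * D / (8 * Δ)) * c) ^ 2 = L * Δ / (8 * D) * c ^ 2 := by
  rw [mul_pow, mul_pow, Real.sq_sqrt (by positivity)]
  constructor <;> field_simp

/-- The hardness due to lossy compression. -/
lemma exists_hard_for_compression {Δ L σ δ : ℝ} {n T : ℕ} (hΔ : 0 < Δ) (hL : 0 < L) (hn : 2 ≤ n)
    (hδ : 0 < δ) (hδ1 : δ ≤ 1) (hT : 1 ≤ T * δ) :
    ∃ (d : ℕ) (f : Fin n → E d → ℝ) (O : Fin n → Oracle d) (C : Compressors n d),
      0 < d ∧ SmoothClass Δ L 0 f ∧ (∀ i, (O i).InClass σ (f i)) ∧ C.Contractive δ ∧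
      ∀ A : Algorithm.{u} n d, Admissible A O C 0 T →
        ∀ xhat : Outcome A O C → E d, IsOutput A O C T xhat →
          ENNReal.ofReal (1 / 11520 * (Δ * L / (δ * T))) ≤
            ∫⁻ ω, ‖gradient (average f) (xhat ω)‖ₑ ^ 2 ∂(outcomeLaw A O C) := by
  classical
  -- Twice the mean number of surviving rounds among `T`, as Markov's inequality requires for
  -- probability 1/2.
  set N : ℕ := ⌈2 * (T * δ)⌉₊ with hN
  have hN1 : 2 * (T * δ) ≤ N := Nat.le_ceil _
  have hN2 : (N : ℝ) < 2 * (T * δ) + 1 := Nat.ceil_lt_add_one (by positivity)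
  have hN0 : 0 < N := Nat.ceil_pos.2 (by linarith)
  -- The extra coordinate is needed because a worker may know one coordinate more than the server.
  set d : ℕ := N + 1 with hd
  have hdr : (d : ℝ) + 1 = N + 2 := by rw [hd]; push_cast; ring
  have hD : (0 : ℝ) < d + 1 := by positivity
  set a : ℝ := Δ / (d + 1)
  set r : ℝ := √(L * (d + 1) / (8 * Δ))
  have ha : 0 ≤ a := by positivity
  have hr : 0 ≤ r := by positivity
  have hδI : δ ∈ Set.Icc (0 : ℝ) 1 := ⟨hδ.le, hδ1⟩
  set w : Fin n → ℕ → ℝ := fun i k => if (i : ℕ) % 2 = k % 2 then 1 else 0 with hw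
  have w0 : ∀ i k, 0 ≤ w i k := fun i k => by simp only [w]; split_ifs <;> norm_num
  have w1 : ∀ i k, w i k ≤ 1 := fun i k => by simp only [w]; split_ifs <;> norm_num
  -- Each parity class has at least ⌊n/2⌋ workers; the worst share, 1/3, occurs at n = 3.
  have wavg : ∀ k, (1 / 3 : ℝ) ≤ (∑ i, w i k) / n := by
    intro k
    have e1 : ∑ i, w i k = ((Finset.range n).filter fun i => i % 2 = k % 2).card := by
      simp only [w]
      rw [Fin.sum_univ_eq_sum_range (fun i => if i % 2 = k % 2 then (1 : ℝ) else 0) n,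
        Finset.sum_boole]
    have e2 : n / 2 ≤ ((Finset.range n).filter fun i => i % 2 = k % 2).card := by
      conv_lhs => rw [← Finset.card_range (n / 2)]
      refine Finset.card_le_card_of_injOn (fun l => 2 * l + k % 2) (fun l hl => ?_)
        (fun l _ l' _ h => by simp only at h; omega)
      simp only [Finset.coe_range, Set.mem_Iio, Finset.coe_filter, Finset.mem_range,
        Set.mem_ofPred_eq] at hl ⊢
      omega
    have e3 : (n : ℝ) ≤ 3 * ((Finset.range n).filter fun i => i % 2 = k % 2).card := by
      exact_mod_cast (by omega : n ≤ 3 * _)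
    have hn0 : (0 : ℝ) < n := by exact_mod_cast (by omega : 0 < n)
    rw [e1, le_div_iff₀ hn0]; linarith
  refine ⟨d, fun i => chain a r (w i), fun i => exactOracle (chain a r (w i)),
    erasureCompressors n d δ hδI, Nat.succ_pos _,
    smoothClass_chain ha (scale_identities hΔ hL hD 0).1.le (div_mul_cancel₀ _ hD.ne').le w0 w1,
    fun i => exactOracle_inClass (continuous_gradient_chain a r ha (w0 i) (w1 i)).measurable σ,
    erasureCompressors_contractive hδI, ?_⟩
  intro A hA xhat hx
  set O : Fin n → Oracle d := fun i => exactOracle (chain a r (w i)) with hO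
  set C := erasureCompressors n d δ hδI with hC
  let P : ℕ → Outcome A O C → Prop := fun q ω => ω.2.2 q ∈ ({true} : Set Bool)
  have hP : ∀ q, MeasurableSet {ω | P q ω} := fun q =>
    (measurePreserving_rand A O C q).measurable (measurableSet_singleton (α := Bool) true)
  have hPμ : ∀ q, outcomeLaw A O C {ω | P q ω} ≤ ENNReal.ofReal δ := fun q => by
    refine ((measurePreserving_rand A O C q).measure_preimage
      (measurableSet_singleton (α := Bool) true).nullMeasurableSet).trans_le ?_
    exact (coin_singleton_true δ).le
  have main := lintegral_gradient_ge (A := A) (O := O) (C := C) ha hr (by norm_num) wavg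
    (Fin.last N) hx (measurableSet_le_card_filter (Finset.range T) P hP N)
    (measure_le_card_filter_le_half _ (Finset.range T) P hP hPμ hN0
      (by rw [Finset.card_range]; exact hN1)) ?_
  · refine le_trans (ENNReal.ofReal_le_ofReal ?_) main
    rw [(scale_identities hΔ hL hD _).2, hdr]
    have hTδ : 0 < δ * T := by linarith
    rw [show L * Δ / (8 * ((N : ℝ) + 2)) * (1 / 3 / 4) ^ 2 / 2 =
      1 / 2304 * (Δ * L / (N + 2)) by field_simp; norm_num]
    -- The factor 5 comes from N + 2 < 2Tδ + 3 ≤ 5Tδ.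
    rw [show (1 : ℝ) / 11520 * (Δ * L / (δ * T)) = 1 / 2304 * (Δ * L / (5 * (δ * T))) by
      field_simp; norm_num]
    gcongr
    linarith
  · filter_upwards [hA.zeroRespecting, hA.budget] with ω hz hbud hgood i s hs
    have hgood' : ((Finset.range T).filter fun q => P q ω).card < N := not_le.1 hgood
    -- The surviving rounds before phase `t`; the budget keeps them among the first `T` rounds of
    -- the run.
    let S : ℕ → ℕ := fun t => ((Finset.range (state A ω t).used).filter fun q => P q ω).card
    have hS : Monotone S := monotone_nat_of_le_succ fun t =>
      Finset.card_le_card (Finset.filter_subset_filter _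
        (Finset.range_subset_range.2 (Nat.le_add_right _ _)))
    -- Workers with the parity of link `S t` see one coordinate further. In either case link `B t i`
    -- has weight 0 for worker `i`, so the oracle adds nothing and `G = B` is allowed.
    let B : ℕ → Fin n → ℕ := fun t i => S t + if (i : ℕ) % 2 = S t % 2 then 1 else 0
    have hprog := (hz.progress (fun i => hA.start ω i) (B := B) (G := B) (S := S) hS
      (fun _ _ => le_rfl) (fun t i => ?_) (fun t i => Nat.le_add_right _ _) (fun t ht i hy => ?_)
      (fun t ht i htar v hv => ?_) T le_rfl).1 i s hs
    · refine hprog (Fin.last N) ?_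
      have : S T ≤ ((Finset.range T).filter fun q => P q ω).card :=
        Finset.card_le_card (Finset.filter_subset_filter _ (Finset.range_subset_range.2 hbud))
      simp only [B, Fin.val_last]
      split_ifs <;> omega
    · have := hS t.le_succ
      simp only [B, Nat.succ_eq_add_one] at this ⊢
      split_ifs <;> omega
    · have : gAt A ω i t = chainGrad a r (w i) (yAt A ω i t) := gradient_chain a r (w i) _
      rw [this]
      refine below_chainGrad hy le_rfl (fun _ => ?_) a r
      simp only [w, B]
      rw [if_neg]
      split_ifs <;> omega
    · obtain ⟨q, rfl⟩ := (List.mem_ofFn' _ _).1 hv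
      -- A surviving message has support below `S t + 1`, and the survival itself raises the count,
      -- however many rounds the phase has.
      by_cases hq : P ((state A ω t).used + q) ω
      · have hlt : S t < S (t + 1) := by
          refine Finset.card_lt_card ((Finset.ssubset_iff_of_subset (Finset.filter_subset_filter _
            (Finset.range_subset_range.2 (Nat.le_add_right _ _)))).2
              ⟨(state A ω t).used + q, ?_, ?_⟩)
          · exact Finset.mem_filter.2 ⟨Finset.mem_range.2 (Nat.add_lt_add_left q.2 _), hq⟩
          · simp
        have h1 : C.compress i (ω.2.2 ((state A ω t).used + q)) ((state A ω t).target A ω t i q) =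
            (state A ω t).target A ω t i q := if_pos hq
        beta_reduce
        rw [h1]
        refine (htar _ ⟨q, rfl⟩).mono ?_
        simp only [B]
        split_ifs <;> omega
      · have h1 : C.compress i (ω.2.2 ((state A ω t).used + q)) ((state A ω t).target A ω t i q) =
            0 := if_neg hq
        beta_reduce
        rw [h1]
        exact below_zero _

/-- The hardness due to noisy gradients. -/
lemma exists_hard_for_noise {κ Δ L σ δ : ℝ} {n T : ℕ} (hκ : 0 < κ) (hΔ : 0 < Δ) (hL : 0 < L)
    (hσ : 0 < σ) (hn : 0 < n) (hT : 0 < T)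
    (hκT : κ ≤ n * T * (L * Δ / σ ^ 2)) (hR : L * Δ / σ ^ 2 ≤ n * T) :
    ∃ (d : ℕ) (f : Fin n → E d → ℝ) (O : Fin n → Oracle d) (C : Compressors n d),
      0 < d ∧ SmoothClass Δ L 0 f ∧ (∀ i, (O i).InClass σ (f i)) ∧ C.Contractive δ ∧
      ∀ A : Algorithm.{u} n d, Admissible A O C 0 T →
        ∀ xhat : Outcome A O C → E d, IsOutput A O C T xhat →
          ENNReal.ofReal (1 / (256 * (1 / 4 + 2 / √κ)) * √(Δ * L * σ ^ 2 / (n * T))) ≤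
            ∫⁻ ω, ‖gradient (average f) (xhat ω)‖ₑ ^ 2 ∂(outcomeLaw A O C) := by
  classical
  have hn0 : (0 : ℝ) < n := by exact_mod_cast hn
  have hT0 : (0 : ℝ) < T := by exact_mod_cast hT
  set M : ℝ := n * T with hM
  set R : ℝ := L * Δ / σ ^ 2 with hRdef
  have hM0 : 0 < M := by positivity
  have hR0 : 0 < R := by positivity
  -- The variance condition reads LΔ/(32(d+1)) ≤ pσ². As d ≥ 2Mp, it is enough that 64Mp² = R.
  set p : ℝ := √(R / M) / 8 with hp
  have hp0 : 0 < p := by positivity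
  have hp1 : p ≤ 1 := by
    have : √(R / M) ≤ 1 := Real.sqrt_le_one.2 ((div_le_one hM0).2 hR)
    linarith
  have hpI : p ∈ Set.Icc (0 : ℝ) 1 := ⟨hp0.le, hp1⟩
  have hpp : p ^ 2 = R / M / 64 := by
    rw [hp, div_pow, Real.sq_sqrt (by positivity)]; norm_num
  have hMp : 2 * (M * p) = √(M * R) / 4 := by
    have : M * √(R / M) = √(M * R) := by
      rw [show M * R = M ^ 2 * (R / M) by field_simp, Real.sqrt_mul (by positivity),
        Real.sqrt_sq hM0.le]
    rw [hp, ← this]; ring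
  set d : ℕ := ⌈2 * (M * p)⌉₊ with hd
  have hd1 : 2 * (M * p) ≤ d := Nat.le_ceil _
  have hd2 : (d : ℝ) < 2 * (M * p) + 1 := Nat.ceil_lt_add_one (by positivity)
  have hd0 : 0 < d := Nat.ceil_pos.2 (by positivity)
  have hD : (0 : ℝ) < d + 1 := by positivity
  set a : ℝ := Δ / (d + 1)
  set r : ℝ := √(L * (d + 1) / (8 * Δ))
  have ha : 0 ≤ a := by positivity
  have hr : 0 ≤ r := by positivity
  have hvar : (a * r / 2) ^ 2 ≤ p * σ ^ 2 := by
    rw [div_eq_mul_one_div, (scale_identities hΔ hL hD _).2]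
    have e1 : L * Δ = 32 * (2 * (M * p)) * (p * σ ^ 2) := by
      rw [show 32 * (2 * (M * p)) * (p * σ ^ 2) = 64 * M * p ^ 2 * σ ^ 2 by ring, hpp, hRdef]
      field_simp
    rw [e1, show (1 / 2 : ℝ) ^ 2 = 1 / 4 by norm_num, div_mul_div_comm, mul_one,
      div_le_iff₀ (by positivity)]
    have : 0 < p * σ ^ 2 := by positivity
    nlinarith
  have w0 : ∀ (_ : Fin n) (_ : ℕ), (0 : ℝ) ≤ 1 := fun _ _ => zero_le_one
  have w1 : ∀ (_ : Fin n) (_ : ℕ), (1 : ℝ) ≤ 1 := fun _ _ => le_rfl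
  have wavg : ∀ _ : ℕ, (1 : ℝ) ≤ (∑ _i : Fin n, (1 : ℝ)) / n := fun _ => by
    simp [div_self hn0.ne']
  refine ⟨d, fun _ => chain a r fun _ => 1, fun _ => bernoulliOracle p hpI (chain a r fun _ => 1),
    losslessCompressors n d, hd0,
    smoothClass_chain ha (scale_identities hΔ hL hD 0).1.le (div_mul_cancel₀ _ hD.ne').le w0 w1,
    fun i => bernoulliOracle_inClass hpI hp0 ha (w0 i) (w1 i) hvar,
    losslessCompressors_contractive δ, ?_⟩
  intro A hA xhat hx
  set O : Fin n → Oracle d := fun _ => bernoulliOracle p hpI (chain a r fun _ => 1) with hO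
  set C := losslessCompressors n d with hC
  let P : Fin n × ℕ → Outcome A O C → Prop := fun q ω => ω.2.1 q ∈ ({true} : Set Bool)
  have hP : ∀ q, MeasurableSet {ω | P q ω} := fun q =>
    (measurePreserving_noise A O C q).measurable (measurableSet_singleton (α := Bool) true)
  have hPμ : ∀ q, outcomeLaw A O C {ω | P q ω} ≤ ENNReal.ofReal p := fun q => by
    refine ((measurePreserving_noise A O C q).measure_preimage
      (measurableSet_singleton (α := Bool) true).nullMeasurableSet).trans_le ?_
    exact (coin_singleton_true p).le
  have main := lintegral_gradient_ge (A := A) (O := O) (C := C) ha hr zero_le_one wavg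
    ⟨d - 1, by omega⟩ hx
    (measurableSet_le_card_filter ((Finset.univ : Finset (Fin n)) ×ˢ Finset.range T) P hP d)
    (measure_le_card_filter_le_half _ ((Finset.univ : Finset (Fin n)) ×ˢ Finset.range T) P hP hPμ
      hd0 (by
        rw [Finset.card_product, Finset.card_univ, Fintype.card_fin, Finset.card_range]
        push_cast; exact hd1)) ?_
  · refine le_trans (ENNReal.ofReal_le_ofReal ?_) main
    rw [(scale_identities hΔ hL hD _).2]
    have hMR : 0 < √(M * R) := by positivity
    have hsκ : 0 < √κ := by positivity
    -- Here `κ` enters: rounding up and the additional link cost at most 2, which √(MR) ≥ √κ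
    -- absorbs.
    have e1 : (d : ℝ) + 1 ≤ (1 / 4 + 2 / √κ) * √(M * R) := by
      have e2 : √κ ≤ √(M * R) := Real.sqrt_le_sqrt hκT
      have e3 : 2 ≤ 2 / √κ * √(M * R) := by
        rw [div_mul_eq_mul_div, le_div_iff₀ hsκ]; linarith
      rw [add_mul]; linarith
    have e4 : √(Δ * L * σ ^ 2 / (n * T)) = L * Δ / √(M * R) := by
      rw [eq_div_iff hMR.ne', ← Real.sqrt_mul (by positivity), ← hM, hRdef,
        show Δ * L * σ ^ 2 / M * (M * (L * Δ / σ ^ 2)) = (L * Δ) ^ 2 by field_simp,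
        Real.sqrt_sq (by positivity)]
    rw [e4]
    calc 1 / (256 * (1 / 4 + 2 / √κ)) * (L * Δ / √(M * R))
        = L * Δ / (256 * ((1 / 4 + 2 / √κ) * √(M * R))) := by
          rw [div_mul_div_comm, one_mul, mul_assoc]
      _ ≤ L * Δ / (256 * (d + 1)) := by gcongr
      _ = L * Δ / (8 * (d + 1)) * (1 / 4) ^ 2 / 2 := by field_simp; norm_num
  · filter_upwards [hA.zeroRespecting] with ω hz hgood i s hs
    have hgood' : (((Finset.univ : Finset (Fin n)) ×ˢ Finset.range T).filter
      fun q => P q ω).card < d := not_le.1 hgood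
    -- Successful coins of all workers before phase `t`. Any number of successes in one phase
    -- extends the support bound by at most one coordinate, so this count is generous.
    let S : ℕ → ℕ := fun t =>
      (((Finset.univ : Finset (Fin n)) ×ˢ Finset.range t).filter fun q => P q ω).card
    have hsub : ∀ t, ((Finset.univ : Finset (Fin n)) ×ˢ Finset.range t).filter (fun q => P q ω) ⊆
        ((Finset.univ : Finset (Fin n)) ×ˢ Finset.range (t + 1)).filter (fun q => P q ω) :=
      fun t => Finset.filter_subset_filter _
        (Finset.product_subset_product_right (Finset.range_subset_range.2 t.le_succ))
    have hS : Monotone S := monotone_nat_of_le_succ fun t => Finset.card_le_card (hsub t)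
    have hprog := (hz.progress (fun i => hA.start ω i) (B := fun t _ => S t)
      (G := fun t _ => S (t + 1)) (S := S) hS (fun t _ => hS t.le_succ)
      (fun _ _ => le_rfl) (fun _ _ => le_rfl) (fun t ht i hy => ?_)
      (fun t ht i htar v hv => ?_) T le_rfl).1 i s hs
    · exact hprog _ (Nat.le_sub_one_of_lt hgood')
    · have hgA : gAt A ω i t = (bernoulliOracle p hpI (chain a r fun _ => 1)).eval (yAt A ω i t)
        (ω.2.1 (i, t)) := rfl
      rw [hgA]
      intro j hj
      refine bernoulliOracle_eval_eq_zero ?_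
      by_cases hq : P (i, t) ω
      · have hlt : S t < S (t + 1) := by
          refine Finset.card_lt_card ((Finset.ssubset_iff_of_subset (hsub t)).2 ⟨(i, t), ?_, ?_⟩)
          · exact Finset.mem_filter.2 ⟨by simp, hq⟩
          · simp
        left
        rw [gradient_chain]
        exact below_chainGrad hy hlt.le (by omega) a r j hj
      · exact Or.inr ⟨hy.mono ((hS t.le_succ).trans hj), hq⟩
    · obtain ⟨q, rfl⟩ := (List.mem_ofFn' _ _).1 hv
      exact htar _ ⟨q, rfl⟩

end DistComp

end

/-! ### Choice of the instance with the larger term. -/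

open DistComp in
theorem theorem3 (κ : ℝ) (hκ : 0 < κ) :
    ∃ c : ℝ, 0 < c ∧
      ∀ (Δ L σ δ : ℝ) (n T : ℕ), 0 < Δ → 0 < L → 0 < σ → 2 ≤ n → 0 < δ → δ ≤ 1 →
        (1 / δ) ^ 2 ≤ (T : ℝ) → κ * σ ^ 2 / (n * Δ * L) ≤ (T : ℝ) →
        ∃ (d : ℕ) (f : Fin n → E d → ℝ) (O : Fin n → Oracle d) (C : Compressors n d),
          0 < d ∧ SmoothClass Δ L 0 f ∧ (∀ i, (O i).InClass σ (f i)) ∧ C.Contractive δ ∧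
          ∀ A : Algorithm.{u} n d, Admissible A O C 0 T →
            ∀ xhat : Outcome A O C → E d, IsOutput A O C T xhat →
              ENNReal.ofReal (c * (Real.sqrt (Δ * L * σ ^ 2 / (n * T)) + Δ * L / (δ * T))) ≤
                ∫⁻ ω, ‖gradient (average f) (xhat ω)‖ₑ ^ 2 ∂(outcomeLaw A O C) := by
  set c₁ : ℝ := 1 / (256 * (1 / 4 + 2 / √κ)) with hc₁
  have hc₁0 : 0 < c₁ := by positivity
  refine ⟨min c₁ (1 / 11520) / 2, by positivity, ?_⟩
  intro Δ L σ δ n T hΔ hL hσ hn hδ hδ1 hT hκT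
  have hmin1 : min c₁ (1 / 11520) ≤ c₁ := min_le_left _ _
  have hmin2 : min c₁ (1 / 11520) ≤ 1 / 11520 := min_le_right _ _
  have hmin0 : 0 < min c₁ (1 / 11520) := by positivity
  have hTr : (0 : ℝ) < T := lt_of_lt_of_le (by positivity) hT
  have hT0 : 0 < T := by exact_mod_cast hTr
  have hn0 : (0 : ℝ) < n := by exact_mod_cast (by omega : 0 < n)
  have hn1 : (1 : ℝ) ≤ n := by exact_mod_cast (by omega : 1 ≤ n)
  have hTδ : 1 ≤ T * δ := by
    have h1 : 1 / δ ≤ (1 / δ) ^ 2 := by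
      have : 1 ≤ 1 / δ := by rwa [le_div_iff₀ hδ, one_mul]
      nlinarith
    have := h1.trans hT
    rwa [div_le_iff₀ hδ] at this
  set t₁ := √(Δ * L * σ ^ 2 / (n * T)) with ht₁
  set t₂ := Δ * L / (δ * T) with ht₂
  have ht₁0 : 0 ≤ t₁ := Real.sqrt_nonneg _
  have ht₂0 : 0 ≤ t₂ := by positivity
  by_cases hle : t₁ ≤ t₂
  · obtain ⟨d, f, O, C, h0, h1, h2, h3, h4⟩ :=
      exists_hard_for_compression.{u} (σ := σ) hΔ hL hn hδ hδ1 hTδ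
    refine ⟨d, f, O, C, h0, h1, h2, h3, fun A hA xhat hx =>
      (ENNReal.ofReal_le_ofReal ?_).trans (h4 A hA xhat hx)⟩
    nlinarith
  · have hκT' : κ ≤ n * T * (L * Δ / σ ^ 2) := by
      rw [div_le_iff₀ (by positivity)] at hκT
      rw [← mul_div_assoc, le_div_iff₀ (by positivity)]
      linarith
    -- This makes the coin bias at most 1. If it failed, then t₁ ≤ ΔL/(nT) ≤ t₂ because δ ≤ 1 ≤ n,
    -- and the compression case would apply.
    have hR : L * Δ / σ ^ 2 ≤ n * T := by
      by_contra hlt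
      rw [not_le, lt_div_iff₀ (by positivity)] at hlt
      refine hle ?_
      have e1 : t₁ ≤ Δ * L / (n * T) := by
        rw [ht₁]
        refine Real.sqrt_le_iff.2 ⟨by positivity, ?_⟩
        rw [div_pow, div_le_div_iff₀ (by positivity) (by positivity)]
        have : 0 < Δ * L * (n * T) := by positivity
        nlinarith
      refine e1.trans ?_
      rw [ht₂]
      gcongr
      linarith
    obtain ⟨d, f, O, C, h0, h1, h2, h3, h4⟩ :=
      exists_hard_for_noise.{u} (n := n) (δ := δ) hκ hΔ hL hσ (by omega) hT0 hκT' hR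
    refine ⟨d, f, O, C, h0, h1, h2, h3, fun A hA xhat hx =>
      (ENNReal.ofReal_le_ofReal ?_).trans (h4 A hA xhat hx)⟩
    rw [not_le] at hle
    nlinarith
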